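/- Let $n\ge 0$ and let $D$ be a digraph on $[n]=\{1,\dots,n\}$ (any set of directed edges $(u,v)\in[n]\times[n]$, loops allowed). Let $A\in\{0,1\}^{n\times n}$ be its adjacency matrix, $\overline{A}=\vec 1\vec 1^{T}-A$ the adjacency matrix of the complement, and $X=\mathrm{diag}(x_1,\dots,x_n)$. Let $h_k,e_k,p_k$ be the complete homogeneous, elementary and power sum symmetric functions in $\vec z=(z_1,z_2,\dots)$, over $\mathbb{Q}$, and put $H_{\vec z}(t)=\sum_{k\ge0}h_kt^k$, $E_{\vec z}(t)=\sum_{k\ge0}e_kt^k$. For a permutation $\sigma$ of a finite set let $p_{\mathrm{cyc}(\sigma)}$ be the product of $p_k$ over the lengths $k$ of the cycles of $\sigma$ (fixed points included). For a power series $f$ in $x_1,\dots,x_n$ let $\mathfrak{L}_n f$ be the coefficient of $x_1x_2\cdots x_n$ in $f$. The Rédei–Berge symmetric function of $D$ is $$\mathcal{U}_D=\sum_{\pi\in\mathfrak{S}_n}F_{\mathrm{Des}_D(\pi)},\qquad F_J=\sum_{\substack{1\le i_1\le\cdots\le i_n\\ i_j<i_{j+1}\text{ for }j\in J}}z_{i_1}\cdots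 z_{i_n}\quad(J\subseteq[n-1]),$$ where $\mathrm{Des}_D(\pi)$ is the set of $j\in[n-1]$ such that $(\pi(j),\pi(j+1))$ is an edge of $D$. Then: (a) $\displaystyle \mathcal{U}_D=\mathfrak{L}_n\big(\det H_{\vec z}(X\overline{A})\cdot\det E_{\vec z}(XA)\big)$; (b) $\displaystyle \mathcal{U}_D=\mathfrak{L}_n\exp\Big(\sum_{k\ge1}\frac1k\,p_k\big(\mathrm{tr}\,(X\overline{A})^k+(-1)^{k-1}\,\mathrm{tr}\,(XA)^k\big)\Big)$; (c) $\displaystyle \mathcal{U}_D=\sum_{I\subseteq[n]}\Big(\sum_{\sigma\in\mathfrak{S}_{I^c}}p_{\mathrm{cyc}(\sigma)}\prod_{i\in I^c}\overline{A}_{i,\sigma(i)}\Big)\Big(\sum_{\tau\in\mathfrak{S}_I}p_{\mathrm{cyc}(\tau)}\,\mathrm{sgn}(\tau)\prod_{i\in I}A_{i,\tau(i)}\Big)$, where $I^c=[n]\setminus I$ and $\mathfrak{S}_I$ is the group of permutations of $I$. -/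

import Mathlib

noncomputable section

namespace RedeiBerge

/-- The formal sum of a family of multivariate power series, computed coefficient by coefficient.
It is used only for families in which each monomial occurs in finitely many members. -/
def formalSum {ι σ R : Type*} [CommRing R] (f : ι → MvPowerSeries σ R) : MvPowerSeries σ R :=
  fun d => ∑ᶠ k : ι, MvPowerSeries.coeff d (f k)

/-- Formal power series over `ℚ` in the countably many indeterminates `z_0, z_1, z_2, …`.
Symmetric functions are regarded as elements of this ring. -/
abbrev ZSeries : Type := MvPowerSeries ℕ ℚ

/-- Formal power series in `x_i` (`i : Fin n`) with coefficients in `ZSeries`. -/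
abbrev XSeries (n : ℕ) : Type := MvPowerSeries (Fin n) ZSeries

/-! ### Symmetric and quasisymmetric functions -/

/-- The complete homogeneous symmetric function: the sum of all monomials of degree `k`. -/
def h (k : ℕ) : ZSeries :=
  formalSum fun s : Sym ℕ k => ((s : Multiset ℕ).map MvPowerSeries.X).prod

/-- The elementary symmetric function: the sum of all squarefree monomials of degree `k`. -/
def e (k : ℕ) : ZSeries :=
  formalSum fun s : {s : Finset ℕ // s.card = k} => ∏ i ∈ s.1, MvPowerSeries.X i

/-- The power sum symmetric function `∑ i, z_i ^ k`, meaningful for `k ≥ 1`. -/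
def p (k : ℕ) : ZSeries :=
  formalSum fun i : ℕ => (MvPowerSeries.X i) ^ k

/-- The power sum indexed by the cycle type of `σ`. Fixed points count as parts of size `1`. -/
def pCyc {α : Type*} [Fintype α] [DecidableEq α] (σ : Equiv.Perm α) : ZSeries :=
  (σ.partition.parts.map p).prod

/-- The fundamental quasisymmetric function of degree `n` for a set `I` of positions.
Positions are numbered from `0`, so the relevant ones are the `j` with `j + 1 < n`. -/
def F (n : ℕ) (I : Set ℕ) : ZSeries :=
  formalSum fun s : {s : Fin n → ℕ // Monotone s ∧
      ∀ (j : ℕ) (hj : j + 1 < n), j ∈ I → s ⟨j, by omega⟩ < s ⟨j + 1, hj⟩} =>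
    ∏ j : Fin n, MvPowerSeries.X (s.1 j)

/-! ### The Rédei–Berge symmetric function -/

/-- The set of `D`-descents of a permutation (positions numbered from `0`). -/
def descents {n : ℕ} (D : Digraph (Fin n)) (π : Equiv.Perm (Fin n)) : Set ℕ :=
  {j | ∃ hj : j + 1 < n, D.Adj (π ⟨j, by omega⟩) (π ⟨j + 1, hj⟩)}

/-- The Rédei–Berge symmetric function of `D`. -/
def U {n : ℕ} (D : Digraph (Fin n)) : ZSeries :=
  ∑ π : Equiv.Perm (Fin n), F n (descents D π)

/-! ### Matrices and coefficient extraction -/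

open Classical in
/-- The adjacency matrix of `D`, with entries in a commutative ring `R`. -/
def adj {n : ℕ} (R : Type*) [CommRing R] (D : Digraph (Fin n)) : Matrix (Fin n) (Fin n) R :=
  Matrix.of fun i j => if D.Adj i j then 1 else 0

/-- The matrix `X A`, where `X = diag(x_1, …, x_n)` and `A` is the adjacency matrix of `D`. -/
def XA {n : ℕ} (D : Digraph (Fin n)) : Matrix (Fin n) (Fin n) (XSeries n) :=
  Matrix.diagonal (fun i => MvPowerSeries.X i) * adj (XSeries n) D

/-- The generating series `H_z(t) = ∑ k, h_k t ^ k`. -/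
def H : PowerSeries ZSeries := PowerSeries.mk h

/-- The generating series `E_z(t) = ∑ k, e_k t ^ k`. -/
def E : PowerSeries ZSeries := PowerSeries.mk e

/-- Evaluation of `f(t) = ∑ k, f_k t ^ k` at a square matrix: `f(M) = ∑ k, f_k M ^ k`. -/
def evalMatrix {n : ℕ} (f : PowerSeries ZSeries) (M : Matrix (Fin n) (Fin n) (XSeries n)) :
    Matrix (Fin n) (Fin n) (XSeries n) :=
  Matrix.of fun i j => formalSum fun k : ℕ => PowerSeries.coeff k f • (M ^ k) i j

/-- The linear coefficient operator: the coefficient of `x_1 x_2 ⋯ x_n`. -/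
def linCoeff {n : ℕ} (f : XSeries n) : ZSeries :=
  MvPowerSeries.coeff (∑ i : Fin n, Finsupp.single i 1) f

/-- The formal exponential of a series with zero constant term. -/
def expSeries {n : ℕ} (f : XSeries n) : XSeries n :=
  PowerSeries.subst f (PowerSeries.exp ℚ)

end RedeiBerge

end

noncomputable section

namespace RedeiBerge

/-! All three formulas follow from one fact: a power series with constant term `1` is determined by
its logarithmic derivative under the Euler derivation (`eq_of_euler_eq_mul`), so products,
determinants and exponentials can be compared without logarithms.

Keep only the colours `z_0, …, z_(N-1)`, and let a letter be a pair (vertex, colour) of weight `x_v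
z_j`. A letter may follow another if the colour increases, or if it stays the same along a non-edge
of `D`; let `T` be this transfer matrix, `L` the diagonal matrix of weights and `J` the all-ones
matrix. Words using every vertex exactly once are exactly the terms of the Rédei–Berge function in
`N` variables. Since `L J` has rank one, the matrix determinant lemma identifies `det (1 + L (J -
T)) / det (1 - L T)` with the generating series of all words, the empty one included. Both
determinants are block triangular by colour, so this ratio is `∏ j, det (1 + z_j X A) / det (1 - z_j
X Ā)`. By Jacobi's formula its logarithmic Euler derivative is `∑ k, p_k (tr (X Ā)^k + (-1)^(k-1) tr
(X A)^k)`, with power sums in `N` variables.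

Reading such a differential equation on squarefree monomials gives a recursion over subsets.
Permutation sums weighted by cycle lengths satisfy the same recursion, by splitting off the cycle
through a marked point (`card_mul_permSum`, `coeff_ind_eq_permSum`). This proves (c) for `N`
colours. Both sides converge coefficientwise as `N` grows, which gives `U_eq_sum_permSum`. The
Newton identities show that the series in (a) has the corresponding logarithmic derivative with the
full power sums, and the chain rule shows it for the one in (b); `U_eq_linCoeff` then yields both.
-/

/-! ### The Euler derivation and logarithmic derivatives -/

section Euler

variable {σ R : Type*} [CommRing R]

open MvPowerSeries in
/-- The Euler derivation, multiplying each coefficient by its total degree. -/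
def euler (σ R : Type*) [CommRing R] : Derivation R (MvPowerSeries σ R) (MvPowerSeries σ R) :=
  Derivation.mk'
    { toFun := fun f d => d.degree • coeff d f
      map_add' := fun f g => by
        ext d
        change d.degree • coeff d (f + g) = d.degree • coeff d f + d.degree • coeff d g
        rw [map_add, smul_add]
      map_smul' := fun r f => by
        ext d
        change d.degree • coeff d (r • f) = r * (d.degree • coeff d f)
        rw [coeff_smul, mul_smul_comm] }
    (fun f g => by
      classical
      ext d
      change d.degree • coeff d (f * g) = coeff d (f * (show MvPowerSeries σ R from fun d => d.degree • coeff d g)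
        + g * (show MvPowerSeries σ R from fun d => d.degree • coeff d f))
      rw [map_add, mul_comm g, coeff_mul, coeff_mul, coeff_mul, Finset.smul_sum,
        ← Finset.sum_add_distrib]
      refine Finset.sum_congr rfl fun x hx => ?_
      change _ = coeff x.1 f * (x.2.degree • coeff x.2 g) + (x.1.degree • coeff x.1 f) * coeff x.2 g
      rw [← Finset.HasAntidiagonal.mem_antidiagonal.1 hx, map_add, mul_smul_comm, smul_mul_assoc, ← add_smul,
        add_comm])

theorem coeff_euler (f : MvPowerSeries σ R) (d : σ →₀ ℕ) :
    MvPowerSeries.coeff d (euler σ R f) = d.degree • MvPowerSeries.coeff d f := rfl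

/-- A power series is determined by its logarithmic Euler derivative and its constant term. -/
theorem eq_of_euler_eq_mul [Algebra ℚ R] {y y' k : MvPowerSeries σ R}
    (hk : MvPowerSeries.constantCoeff k = 0)
    (hy : euler σ R y = y * k) (hy' : euler σ R y' = y' * k)
    (h0 : MvPowerSeries.constantCoeff y = MvPowerSeries.constantCoeff y') : y = y' := by
  classical
  have := IsAddTorsionFree.of_module_rat R
  rw [← sub_eq_zero]
  have hw : euler σ R (y - y') = (y - y') * k := by rw [map_sub, hy, hy', sub_mul]
  have hw0 : MvPowerSeries.constantCoeff (y - y') = 0 := by rw [map_sub, h0, sub_self]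
  generalize y - y' = w at hw hw0
  -- Since `k` has no constant term, the degree-`m` part of `w * k` involves only coefficients of
  -- `w` of degree below `m`, while the left side multiplies those of degree `m` by `m`.
  have key : ∀ (m : ℕ) (d : σ →₀ ℕ), d.degree = m → MvPowerSeries.coeff d w = 0 := by
    intro m
    induction m using Nat.strong_induction_on with
    | _ m ih =>
      intro d hd
      by_cases hm : m = 0
      · have : d = 0 := (Finsupp.degree_eq_zero_iff d).1 (hd.trans hm)
        rw [this]
        exact hw0
      have h1 := congrArg (MvPowerSeries.coeff d) hw
      rw [coeff_euler, MvPowerSeries.coeff_mul, Finset.sum_eq_zero, hd] at h1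
      · exact (smul_eq_zero_iff_right hm).1 h1
      · intro x hx
        have hx' := Finset.HasAntidiagonal.mem_antidiagonal.1 hx
        by_cases hx2 : x.2 = 0
        · rw [hx2]
          have : MvPowerSeries.coeff 0 k = 0 := hk
          rw [this, mul_zero]
        · rw [ih x.1.degree _ _ rfl, zero_mul]
          have h2 : x.2.degree ≠ 0 := fun h => hx2 ((Finsupp.degree_eq_zero_iff _).1 h)
          have h3 : x.1.degree + x.2.degree = m := by rw [← map_add, hx', hd]
          omega
  ext d
  exact key _ d rfl

/-- The chain rule for the exponential series. -/
theorem euler_subst_exp [Algebra ℚ R] {g : MvPowerSeries σ R}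
    (hg : MvPowerSeries.constantCoeff g = 0) :
    euler σ R (PowerSeries.subst g (PowerSeries.exp ℚ)) =
      PowerSeries.subst g (PowerSeries.exp ℚ) * euler σ R g := by
  classical
  have hs : PowerSeries.HasSubst g := PowerSeries.HasSubst.of_constantCoeff_zero hg
  -- Truncated exponentials: `P K` has the correct coefficients in all degrees below `K`, and
  -- differentiating `P (K + 1)` costs exactly one term.
  let P : ℕ → MvPowerSeries σ R := fun K =>
    ∑ k ∈ Finset.range K, (1 / (k.factorial : ℚ)) • g ^ k
  have hP : ∀ (K : ℕ) (d : σ →₀ ℕ), d.degree < K →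
      MvPowerSeries.coeff d (PowerSeries.subst g (PowerSeries.exp ℚ)) =
        MvPowerSeries.coeff d (P K) := by
    intro K d hd
    rw [PowerSeries.coeff_subst hs, finsum_eq_sum_of_support_subset (s := Finset.range K)]
    · simp only [P, map_sum]
      refine Finset.sum_congr rfl fun k _ => ?_
      simp [PowerSeries.coeff_exp]
    · intro k hk
      by_contra h
      refine hk ?_
      change _ • MvPowerSeries.coeff d (g ^ k) = _
      rw [MvPowerSeries.coeff_of_lt_order, smul_zero]
      refine lt_of_lt_of_le ?_ (MvPowerSeries.le_order_pow_of_constantCoeff_eq_zero k hg)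
      simp only [Finset.coe_range, Set.mem_Iio, not_lt] at h
      exact_mod_cast hd.trans_le h
  have hD : ∀ K, euler σ R (P (K + 1)) = P K * euler σ R g := by
    intro K
    simp only [P]
    rw [Finset.sum_range_succ', map_add, map_sum, Finset.sum_mul]
    have h0 : euler σ R ((1 / ((0 : ℕ).factorial : ℚ)) • g ^ 0) = 0 := by simp
    rw [h0, add_zero]
    refine Finset.sum_congr rfl fun k _ => ?_
    rw [map_rat_smul, Derivation.leibniz_pow, Nat.add_sub_cancel, smul_eq_mul, smul_mul_assoc,
      ← Nat.cast_smul_eq_nsmul ℚ, smul_smul, Nat.factorial_succ]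
    congr 1
    have : ((k : ℚ) + 1) ≠ 0 := by positivity
    have : (k.factorial : ℚ) ≠ 0 := by positivity
    push_cast
    field_simp
  ext d
  rw [coeff_euler, hP (d.degree + 1 + 1) d (by omega), ← coeff_euler, hD, MvPowerSeries.coeff_mul,
    MvPowerSeries.coeff_mul]
  refine Finset.sum_congr rfl fun x hx => ?_
  rw [hP (d.degree + 1)]
  rw [← Finset.HasAntidiagonal.mem_antidiagonal.1 hx, map_add]
  omega

theorem constantCoeff_subst_exp [Algebra ℚ R] {g : MvPowerSeries σ R}
    (hg : MvPowerSeries.constantCoeff g = 0) :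
    MvPowerSeries.constantCoeff (PowerSeries.subst g (PowerSeries.exp ℚ)) = 1 := by
  rw [PowerSeries.constantCoeff_subst (PowerSeries.HasSubst.of_constantCoeff_zero hg),
    finsum_eq_single _ 0]
  · simp
  · intro k hk
    simp [hg, hk]

end Euler

/-- Jacobi's formula for a derivation. -/
theorem derivation_det {ι R A : Type*} [Fintype ι] [DecidableEq ι] [CommRing R] [CommRing A]
    [Algebra R A] (δ : Derivation R A A) (M : Matrix ι ι A) :
    δ M.det = (M.adjugate * M.map δ).trace := by
  have hprod : ∀ (s : Finset ι) (f : ι → A),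
      δ (∏ i ∈ s, f i) = ∑ i ∈ s, (∏ j ∈ s.erase i, f j) * δ (f i) := by
    intro s f
    induction s using Finset.induction_on with
    | empty => simp
    | insert a s ha ih =>
      rw [Finset.prod_insert ha, Derivation.leibniz, ih, Finset.sum_insert ha,
        Finset.erase_insert ha, smul_eq_mul, smul_eq_mul, Finset.mul_sum, add_comm]
      congr 1
      refine Finset.sum_congr rfl fun i hi => ?_
      have hai : a ≠ i := fun h => ha (h ▸ hi)
      rw [Finset.erase_insert_of_ne hai, Finset.prod_insert (by simp [ha]), mul_assoc]
  -- By Cramer's rule, each diagonal entry is the determinant with one column differentiated; the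
  -- Leibniz rule on the permutation expansion gives the same sum.
  have h1 : (M.adjugate * M.map δ).trace =
      ∑ i, (M.updateCol i (fun k => δ (M k i))).det := by
    rw [Matrix.trace]
    refine Finset.sum_congr rfl fun i _ => ?_
    rw [← Matrix.cramer_apply, Matrix.cramer_eq_adjugate_mulVec]
    rfl
  rw [h1, Matrix.det_apply', map_sum]
  simp_rw [Matrix.det_apply']
  rw [Finset.sum_comm]
  refine Finset.sum_congr rfl fun τ _ => ?_
  rw [Derivation.leibniz, hprod]
  have h2 : δ (((Equiv.Perm.sign τ : ℤ)) : A) = 0 := by simp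
  rw [h2, smul_zero, add_zero, smul_eq_mul, Finset.mul_sum]
  refine Finset.sum_congr rfl fun i _ => ?_
  rw [← Finset.mul_prod_erase Finset.univ _ (Finset.mem_univ i), Matrix.updateCol_self,
    mul_comm (∏ j ∈ _, _)]
  congr 2
  refine Finset.prod_congr rfl fun j hj => ?_
  rw [Matrix.updateCol_ne (Finset.ne_of_mem_erase hj)]

/-! ### Power series in matrices of linear forms -/

/-- `f` is homogeneous of degree `m`. -/
def Homog {σ R : Type*} [CommRing R] (m : ℕ) (f : MvPowerSeries σ R) : Prop :=
  ∀ d : σ →₀ ℕ, d.degree ≠ m → MvPowerSeries.coeff d f = 0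

section Homog

variable {σ R : Type*} [CommRing R]

theorem Homog.sum {ι : Type*} {m : ℕ} {s : Finset ι} {f : ι → MvPowerSeries σ R}
    (h : ∀ i ∈ s, Homog m (f i)) : Homog m (∑ i ∈ s, f i) := fun d hd => by
  rw [map_sum]
  exact Finset.sum_eq_zero fun i hi => h i hi d hd

theorem Homog.mul {m k : ℕ} {f g : MvPowerSeries σ R} (hf : Homog m f) (hg : Homog k g) :
    Homog (m + k) (f * g) := fun d hd => by
  classical
  rw [MvPowerSeries.coeff_mul]
  refine Finset.sum_eq_zero fun x hx => ?_
  by_cases h1 : x.1.degree = m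
  · rw [hg x.2, mul_zero]
    intro h2
    rw [← Finset.HasAntidiagonal.mem_antidiagonal.1 hx, map_add] at hd
    omega
  · rw [hf _ h1, zero_mul]

theorem homog_C (r : R) : Homog 0 (MvPowerSeries.C r : MvPowerSeries σ R) := fun d hd => by
  classical
  rw [MvPowerSeries.coeff_C, if_neg]
  rintro rfl
  simp at hd

theorem homog_X (i : σ) : Homog 1 (MvPowerSeries.X i : MvPowerSeries σ R) := fun d hd => by
  classical
  rw [MvPowerSeries.coeff_X, if_neg]
  rintro rfl
  simp at hd

theorem homog_pow {ι : Type*} [Fintype ι] [DecidableEq ι]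
    {M : Matrix ι ι (MvPowerSeries σ R)} (hM : ∀ i j, Homog 1 (M i j)) (k : ℕ) (i j : ι) :
    Homog k ((M ^ k) i j) := by
  induction k generalizing i j with
  | zero =>
    rw [pow_zero, Matrix.one_apply]
    split_ifs
    · simpa using homog_C (σ := σ) (1 : R)
    · exact fun d _ => map_zero _
  | succ k ih =>
    rw [pow_succ, Matrix.mul_apply]
    exact Homog.sum fun l _ => (ih i l).mul (hM l j)

theorem homog_trace_pow {ι : Type*} [Fintype ι] [DecidableEq ι]
    {M : Matrix ι ι (MvPowerSeries σ R)} (hM : ∀ i j, Homog 1 (M i j)) (k : ℕ) :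
    Homog k ((M ^ k).trace) := Homog.sum fun i _ => homog_pow hM k i i

/-- The series `∑ k, q k * tr (M ^ k)` for a matrix `M` of linear forms. -/
def traceSeries {ι : Type*} [Fintype ι] [DecidableEq ι] (q : ℕ → R)
    (M : Matrix ι ι (MvPowerSeries σ R)) : MvPowerSeries σ R :=
  fun d => q d.degree * MvPowerSeries.coeff d (M ^ d.degree).trace

theorem coeff_traceSeries {ι : Type*} [Fintype ι] [DecidableEq ι] (q : ℕ → R)
    (M : Matrix ι ι (MvPowerSeries σ R)) (d : σ →₀ ℕ) :
    MvPowerSeries.coeff d (traceSeries q M) =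
      q d.degree * MvPowerSeries.coeff d (M ^ d.degree).trace := rfl

theorem constantCoeff_traceSeries {ι : Type*} [Fintype ι] [DecidableEq ι] {q : ℕ → R}
    (hq : q 0 = 0) (M : Matrix ι ι (MvPowerSeries σ R)) :
    MvPowerSeries.constantCoeff (traceSeries q M) = 0 := by
  rw [← MvPowerSeries.coeff_zero_eq_constantCoeff_apply, coeff_traceSeries, map_zero, hq, zero_mul]

end Homog

variable {n : ℕ} {M : Matrix (Fin n) (Fin n) (XSeries n)}

/-- The entries of `M ^ k` are homogeneous of degree `k`, so a given monomial meets only one term of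
the formal sum. -/
theorem coeff_evalMatrix (hM : ∀ i j, Homog 1 (M i j)) (f : PowerSeries ZSeries) (i j : Fin n)
    (d : Fin n →₀ ℕ) :
    MvPowerSeries.coeff d (evalMatrix f M i j) =
      PowerSeries.coeff d.degree f * MvPowerSeries.coeff d ((M ^ d.degree) i j) := by
  have h : MvPowerSeries.coeff d (evalMatrix f M i j) =
      ∑ᶠ k : ℕ, MvPowerSeries.coeff d (PowerSeries.coeff k f • (M ^ k) i j) := rfl
  rw [h, finsum_eq_single _ d.degree, MvPowerSeries.coeff_smul]
  intro k hk
  rw [MvPowerSeries.coeff_smul, homog_pow hM k i j d hk.symm, mul_zero]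

/-- In `M ^ a * M ^ b`, a pair of monomials can contribute only when their degrees are `a` and `b`;
the Cauchy products of `f * g` and of the matrix entries therefore match pair by pair. -/
theorem evalMatrix_mul (hM : ∀ i j, Homog 1 (M i j)) (f g : PowerSeries ZSeries) :
    evalMatrix (f * g) M = evalMatrix f M * evalMatrix g M := by
  ext1 i j
  refine MvPowerSeries.ext fun d => ?_
  rw [coeff_evalMatrix hM, PowerSeries.coeff_mul, Matrix.mul_apply, map_sum, Finset.sum_mul]
  have h1 : ∀ x ∈ Finset.HasAntidiagonal.antidiagonal d.degree,
      PowerSeries.coeff x.1 f * PowerSeries.coeff x.2 g *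
          MvPowerSeries.coeff d ((M ^ d.degree) i j) =
        ∑ l, ∑ y ∈ Finset.HasAntidiagonal.antidiagonal d,
          PowerSeries.coeff x.1 f * PowerSeries.coeff x.2 g *
            (MvPowerSeries.coeff y.1 ((M ^ x.1) i l) * MvPowerSeries.coeff y.2 ((M ^ x.2) l j)) := by
    intro x hx
    rw [← Finset.HasAntidiagonal.mem_antidiagonal.1 hx, pow_add, Matrix.mul_apply, map_sum,
      Finset.mul_sum]
    refine Finset.sum_congr rfl fun l _ => ?_
    rw [MvPowerSeries.coeff_mul, Finset.mul_sum]
  rw [Finset.sum_congr rfl h1, Finset.sum_comm]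
  refine Finset.sum_congr rfl fun l _ => ?_
  rw [MvPowerSeries.coeff_mul, Finset.sum_comm]
  refine Finset.sum_congr rfl fun y hy => ?_
  rw [Finset.sum_eq_single (y.1.degree, y.2.degree), coeff_evalMatrix hM, coeff_evalMatrix hM]
  · ring
  · intro x hx hne
    by_cases h : y.1.degree = x.1
    · rw [homog_pow hM x.2 l j y.2, mul_zero, mul_zero]
      intro h'
      exact hne (Prod.ext h.symm h'.symm)
    · rw [homog_pow hM x.1 i l y.1 h, zero_mul, mul_zero]
  · intro h
    refine absurd ?_ h
    rw [Finset.HasAntidiagonal.mem_antidiagonal, ← map_add,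
      Finset.HasAntidiagonal.mem_antidiagonal.1 hy]

theorem trace_evalMatrix_mk (hM : ∀ i j, Homog 1 (M i j)) (q : ℕ → ZSeries) :
    (evalMatrix (PowerSeries.mk q) M).trace = traceSeries q M := by
  refine MvPowerSeries.ext fun d => ?_
  rw [coeff_traceSeries, Matrix.trace, map_sum, Matrix.trace, map_sum, Finset.mul_sum]
  refine Finset.sum_congr rfl fun i _ => ?_
  rw [Matrix.diag_apply, coeff_evalMatrix hM, PowerSeries.coeff_mk, Matrix.diag_apply]

/-- The logarithmic Euler derivative of `det f(M)` is `tr q(M)` where `q = t f' / f`. -/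
theorem euler_det_evalMatrix (hM : ∀ i j, Homog 1 (M i j)) {f : PowerSeries ZSeries}
    {q : ℕ → ZSeries}
    (hf : ∀ k : ℕ, (k : ZSeries) * PowerSeries.coeff k f = PowerSeries.coeff k (f * PowerSeries.mk q)) :
    euler (Fin n) ZSeries (evalMatrix f M).det = (evalMatrix f M).det * traceSeries q M := by
  -- The Euler derivation multiplies the degree-`k` part by `k`, so it acts on `f(M)` as `t d/dt`
  -- acts on `f`. In Jacobi's formula the adjugate then cancels against `f(M)`.
  have h1 : (evalMatrix f M).map (euler (Fin n) ZSeries) =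
      evalMatrix f M * evalMatrix (PowerSeries.mk q) M := by
    rw [← evalMatrix_mul hM]
    ext1 i j
    refine MvPowerSeries.ext fun d => ?_
    rw [Matrix.map_apply, coeff_euler, coeff_evalMatrix hM, coeff_evalMatrix hM, ← hf,
      nsmul_eq_mul, mul_assoc]
  rw [derivation_det, h1, ← mul_assoc, Matrix.adjugate_mul, Matrix.smul_mul, one_mul,
    Matrix.trace_smul, trace_evalMatrix_mk hM, smul_eq_mul]

theorem constantCoeff_det_evalMatrix (hM : ∀ i j, Homog 1 (M i j)) {f : PowerSeries ZSeries}
    (hf : PowerSeries.coeff 0 f = 1) :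
    MvPowerSeries.constantCoeff (evalMatrix f M).det = 1 := by
  rw [RingHom.map_det]
  have : (MvPowerSeries.constantCoeff (σ := Fin n) (R := ZSeries)).mapMatrix (evalMatrix f M) = 1 := by
    ext1 i j
    rw [RingHom.mapMatrix_apply, Matrix.map_apply,
      ← MvPowerSeries.coeff_zero_eq_constantCoeff_apply, coeff_evalMatrix hM, map_zero, hf, one_mul,
      pow_zero, Matrix.one_apply, Matrix.one_apply]
    split_ifs <;> simp
  rw [this, Matrix.det_one]

theorem evalMatrix_linear (hM : ∀ i j, Homog 1 (M i j)) (c : ZSeries) :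
    evalMatrix (1 + PowerSeries.C c * PowerSeries.X) M = 1 + (MvPowerSeries.C c : XSeries n) • M := by
  ext1 i j
  refine MvPowerSeries.ext fun d => ?_
  rw [coeff_evalMatrix hM, Matrix.add_apply, Matrix.smul_apply, smul_eq_mul, map_add, map_add,
    MvPowerSeries.coeff_C_mul, PowerSeries.coeff_C_mul, PowerSeries.coeff_one,
    PowerSeries.coeff_X]
  have h0 := homog_pow hM 0 i j d
  have h1 := hM i j d
  rw [pow_zero] at h0
  by_cases hd : d.degree = 0
  · rw [h1 (by omega)]
    simp [hd]
  · rw [h0 hd]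
    by_cases hd1 : d.degree = 1
    · simp [hd1]
    · rw [h1 hd1]
      simp [hd, hd1]

/-! ### Newton identities in infinitely many variables -/

theorem prod_map_X_eq_monomial (s : Multiset ℕ) :
    (s.map (MvPowerSeries.X : ℕ → ZSeries)).prod =
      MvPowerSeries.monomial (Multiset.toFinsupp s) 1 := by
  induction s using Multiset.induction_on with
  | empty => simp
  | cons a s ih =>
    rw [Multiset.map_cons, Multiset.prod_cons, ih, MvPowerSeries.X,
      MvPowerSeries.monomial_mul_monomial, one_mul, ← Multiset.singleton_add, map_add,
      Multiset.toFinsupp_singleton]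

theorem degree_toFinsupp (s : Multiset ℕ) : (Multiset.toFinsupp s).degree = Multiset.card s := by
  induction s using Multiset.induction_on with
  | empty => simp
  | cons a s ih =>
    rw [← Multiset.singleton_add, map_add, map_add, ih, Multiset.toFinsupp_singleton,
      Finsupp.degree_single, Multiset.card_add, Multiset.card_singleton]

theorem coeff_h (k : ℕ) (d : ℕ →₀ ℕ) :
    MvPowerSeries.coeff d (h k) = if d.degree = k then 1 else 0 := by
  have h1 : MvPowerSeries.coeff d (h k) = ∑ᶠ s : Sym ℕ k,
      MvPowerSeries.coeff d (((s : Multiset ℕ).map (MvPowerSeries.X : ℕ → ZSeries)).prod) := rfl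
  simp_rw [h1, prod_map_X_eq_monomial, MvPowerSeries.coeff_monomial]
  split_ifs with hd
  · have hc : Multiset.card (Finsupp.toMultiset d) = k := by
      rw [← hd, ← degree_toFinsupp, Finsupp.toMultiset_toFinsupp]
    rw [finsum_eq_single _ (Sym.mk (Finsupp.toMultiset d) hc)]
    · simp
    · intro s hs
      rw [if_neg]
      rintro rfl
      exact hs (Subtype.ext (by simp))
  · rw [finsum_eq_zero_of_forall_eq_zero]
    intro s
    rw [if_neg]
    rintro rfl
    exact hd (by rw [degree_toFinsupp, Sym.card_coe])

theorem coeff_e (k : ℕ) (d : ℕ →₀ ℕ) [Decidable (d.degree = k ∧ ∀ i, d i ≤ 1)] :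
    MvPowerSeries.coeff d (e k) = if d.degree = k ∧ ∀ i, d i ≤ 1 then 1 else 0 := by
  have h1 : MvPowerSeries.coeff d (e k) = ∑ᶠ s : {s : Finset ℕ // s.card = k},
      MvPowerSeries.coeff d ((s.1.val.map (MvPowerSeries.X : ℕ → ZSeries)).prod) := rfl
  simp_rw [h1, prod_map_X_eq_monomial, MvPowerSeries.coeff_monomial]
  split_ifs with hd
  · have hds : Multiset.toFinsupp d.support.val = d := by
      ext i
      rw [Multiset.toFinsupp_apply, Multiset.count_eq_of_nodup d.support.nodup]
      have := hd.2 i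
      simp only [Finset.mem_val, Finsupp.mem_support_iff]
      split_ifs <;> omega
    have hc : d.support.card = k := by
      rw [← hd.1]
      conv_rhs => rw [← hds, degree_toFinsupp]
      rfl
    rw [finsum_eq_single _ ⟨d.support, hc⟩]
    · simp [hds]
    · intro s hs
      rw [if_neg]
      intro h
      refine hs (Subtype.ext ?_)
      ext i
      change i ∈ s.1 ↔ i ∈ d.support
      rw [h]
      simp
  · rw [finsum_eq_zero_of_forall_eq_zero]
    intro s
    rw [if_neg]
    rintro rfl
    refine hd ⟨by rw [degree_toFinsupp]; exact s.2, fun i => ?_⟩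
    rw [Multiset.toFinsupp_apply, Multiset.count_eq_of_nodup s.1.nodup]
    split_ifs <;> simp

theorem coeff_p {k : ℕ} (hk : k ≠ 0) (d : ℕ →₀ ℕ) [Decidable (∃ j, d = Finsupp.single j k)] :
    MvPowerSeries.coeff d (p k) = if ∃ j, d = Finsupp.single j k then 1 else 0 := by
  classical
  have h1 : MvPowerSeries.coeff d (p k) = ∑ᶠ i : ℕ,
      MvPowerSeries.coeff d ((MvPowerSeries.X i : ZSeries) ^ k) := rfl
  simp_rw [h1, MvPowerSeries.coeff_X_pow]
  split_ifs with hd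
  · obtain ⟨j, rfl⟩ := hd
    rw [finsum_eq_single _ j]
    · simp
    · intro i hi
      rw [if_neg]
      intro h
      exact hi ((Finsupp.single_left_inj hk).1 h).symm
  · rw [finsum_eq_zero_of_forall_eq_zero]
    intro i
    rw [if_neg]
    exact fun h => hd ⟨i, h⟩

theorem homog_h (k : ℕ) : Homog k (h k) := fun d hd => by rw [coeff_h, if_neg hd]

theorem homog_e (k : ℕ) : Homog k (e k) := fun d hd => by
  classical
  rw [coeff_e, if_neg fun h => hd h.1]

/-- The coefficients of a product `∑ g_a c_b p_b` in terms of those of `g`. -/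
theorem coeff_sum_mul_powerSum {g q : ℕ → ZSeries} {c : ℕ → ℚ} (hg : ∀ k, Homog k (g k))
    (hq0 : q 0 = 0)
    (hq : ∀ m ≠ 0, ∀ d : ℕ →₀ ℕ, MvPowerSeries.coeff d (q m) = c m * MvPowerSeries.coeff d (p m))
    (k : ℕ) (d : ℕ →₀ ℕ) :
    MvPowerSeries.coeff d (∑ x ∈ Finset.HasAntidiagonal.antidiagonal k, g x.1 * q x.2) =
      if d.degree = k then ∑ j ∈ d.support, ∑ m ∈ Finset.Icc 1 (d j),
        c m * MvPowerSeries.coeff (d - Finsupp.single j m) (g (k - m)) else 0 := by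
  classical
  have hqd : ∀ m (d : ℕ →₀ ℕ), (m = 0 ∨ ¬ ∃ j, d = Finsupp.single j m) →
      MvPowerSeries.coeff d (q m) = 0 := by
    rintro m d h
    by_cases hm : m = 0
    · rw [hm, hq0, map_zero]
    · rw [hq m hm, coeff_p hm, if_neg (h.resolve_left hm), mul_zero]
  have hqh : ∀ m, Homog m (q m) := fun m d hd => by
    refine hqd m d (Or.inr ?_)
    rintro ⟨j, rfl⟩
    simp at hd
  split_ifs with hd
  swap
  · refine Homog.sum (fun x hx => ?_) d hd
    rw [← Finset.HasAntidiagonal.mem_antidiagonal.1 hx]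
    exact (hg _).mul (hqh _)
  -- By homogeneity, a splitting of the monomial `d` fixes the indices of both factors, so the
  -- double sum collapses to one over splittings.
  have h1 : MvPowerSeries.coeff d (∑ x ∈ Finset.HasAntidiagonal.antidiagonal k, g x.1 * q x.2) =
      ∑ y ∈ Finset.HasAntidiagonal.antidiagonal d,
        MvPowerSeries.coeff y.1 (g y.1.degree) * MvPowerSeries.coeff y.2 (q y.2.degree) := by
    simp_rw [map_sum, MvPowerSeries.coeff_mul]
    rw [Finset.sum_comm]
    refine Finset.sum_congr rfl fun y hy => ?_
    rw [Finset.sum_eq_single (y.1.degree, y.2.degree)]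
    · intro x _ hne
      by_cases h : y.1.degree = x.1
      · rw [hqh x.2 y.2 fun h' => hne (Prod.ext h.symm h'.symm), mul_zero]
      · rw [hg x.1 y.1 h, zero_mul]
    · intro h
      refine absurd ?_ h
      rw [Finset.HasAntidiagonal.mem_antidiagonal, ← map_add,
        Finset.HasAntidiagonal.mem_antidiagonal.1 hy, hd]
  rw [h1, Finset.sum_sigma']
  have hle : ∀ x ∈ d.support.sigma fun j => Finset.Icc 1 (d j),
      d - Finsupp.single x.1 x.2 + Finsupp.single x.1 x.2 = d := by
    intro x hx
    simp only [Finset.mem_sigma, Finset.mem_Icc] at hx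
    exact tsub_add_cancel_of_le (Finsupp.single_le_iff.2 hx.2.2)
  symm
  -- A power sum contains only pure powers `z_j ^ m`, so the surviving splittings remove `m` copies
  -- of one variable. The bound `1 ≤ m` is what makes `j` recoverable.
  refine Finset.sum_of_injOn (fun x => (d - Finsupp.single x.1 x.2, Finsupp.single x.1 x.2))
    ?_ ?_ ?_ ?_
  · rintro ⟨j, m⟩ hx ⟨j', m'⟩ hx' heq
    simp only [Finset.coe_sigma, Set.mem_sigma_iff, Finset.mem_coe, Finset.mem_Icc] at hx hx'
    have h2 := (Finsupp.single_eq_single_iff _ _ _ _).1 (Prod.ext_iff.1 heq).2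
    dsimp only at h2 hx hx'
    obtain ⟨rfl, rfl⟩ : j = j' ∧ m = m' := by
      rcases h2 with h2 | h2
      · exact h2
      · omega
    rfl
  · intro x hx
    rw [Finset.mem_coe, Finset.HasAntidiagonal.mem_antidiagonal]
    exact hle x hx
  · intro y hy hny
    rw [hqd, mul_zero]
    by_contra! hc
    obtain ⟨hm, j, hj⟩ := hc
    refine hny ⟨⟨j, y.2.degree⟩, ?_, ?_⟩
    · have hyd := Finset.HasAntidiagonal.mem_antidiagonal.1 hy
      have h3 : y.2.degree ≤ d j := by
        conv_rhs => rw [← hyd, hj]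
        simp
      simp only [Finset.coe_sigma, Set.mem_sigma_iff, Finset.mem_coe, Finset.mem_Icc,
        Finsupp.mem_support_iff]
      omega
    · have hyd := Finset.HasAntidiagonal.mem_antidiagonal.1 hy
      refine Prod.ext ?_ hj.symm
      change d - Finsupp.single j y.2.degree = y.1
      rw [← hj, ← hyd, add_tsub_cancel_right]
  · rintro ⟨j, m⟩ hx
    have hsum := congrArg Finsupp.degree (hle _ hx)
    simp only [Finset.mem_sigma, Finset.mem_Icc] at hx
    rw [map_add, Finsupp.degree_single, hd] at hsum
    change c m * _ = MvPowerSeries.coeff _ (g (d - Finsupp.single j m).degree) *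
      MvPowerSeries.coeff (Finsupp.single j m) (q (Finsupp.single j m).degree)
    have h4 : (d - Finsupp.single j m).degree = k - m := by
      simp only at hsum
      omega
    rw [h4, Finsupp.degree_single, hq m (by omega), coeff_p (by omega), if_pos ⟨j, rfl⟩]
    ring

/-- The power sums, with the irrelevant term of index `0` replaced by `0`. -/
def powerSum (k : ℕ) : ZSeries := if k = 0 then 0 else p k

/-- The signed power sums `(-1)^(k-1) p_k`, with `0` in degree `0`. -/
def signedPowerSum (k : ℕ) : ZSeries := if k = 0 then 0 else (-1) ^ (k - 1) * p k

/-- Every removal of `m` copies of `z_j`, with `1 ≤ m ≤ d j`, contributes `1`; the total is `∑ j, d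
j = k`. -/
theorem newton_h (k : ℕ) :
    (k : ZSeries) * PowerSeries.coeff k H = PowerSeries.coeff k (H * PowerSeries.mk powerSum) := by
  refine MvPowerSeries.ext fun d => ?_
  rw [PowerSeries.coeff_mul]
  simp_rw [H, PowerSeries.coeff_mk]
  rw [coeff_sum_mul_powerSum (c := fun _ => 1) homog_h (by simp [powerSum])
    (fun m hm d => by simp [powerSum, hm]), ← nsmul_eq_mul, map_nsmul, coeff_h]
  split_ifs with hd
  · have : ∀ j ∈ d.support, ∑ m ∈ Finset.Icc 1 (d j),
        (1 : ℚ) * MvPowerSeries.coeff (d - Finsupp.single j m) (h (k - m)) = d j := by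
      intro j _
      rw [Finset.sum_congr rfl (g := fun _ => (1 : ℚ))]
      · simp
      · intro m hm
        rw [coeff_h, if_pos, one_mul]
        have h1 : d - Finsupp.single j m + Finsupp.single j m = d :=
          tsub_add_cancel_of_le (Finsupp.single_le_iff.2 (Finset.mem_Icc.1 hm).2)
        have h2 := congrArg Finsupp.degree h1
        rw [map_add, Finsupp.degree_single, hd] at h2
        omega
    rw [Finset.sum_congr rfl this, ← hd, nsmul_eq_mul, mul_one, Finsupp.degree_apply]
    push_cast
    rfl
  · simp

theorem newton_e (k : ℕ) :
    (k : ZSeries) * PowerSeries.coeff k E =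
      PowerSeries.coeff k (E * PowerSeries.mk signedPowerSum) := by
  classical
  refine MvPowerSeries.ext fun d => ?_
  rw [PowerSeries.coeff_mul]
  simp_rw [E, PowerSeries.coeff_mk]
  rw [coeff_sum_mul_powerSum (c := fun m => (-1) ^ (m - 1)) homog_e (by simp [signedPowerSum])
    (fun m hm d => by
      have : ((-1 : ZSeries)) ^ (m - 1) = MvPowerSeries.C ((-1) ^ (m - 1)) := by simp
      simp only [signedPowerSum, hm, if_false, this, MvPowerSeries.coeff_C_mul]),
    ← nsmul_eq_mul, map_nsmul, coeff_e]
  by_cases hd : d.degree = k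
  swap
  · simp [hd]
  rw [if_pos hd]
  have hdeg : ∀ j, ∀ m ∈ Finset.Icc 1 (d j), (d - Finsupp.single j m).degree = k - m := by
    intro j m hm
    have h1 : d - Finsupp.single j m + Finsupp.single j m = d :=
      tsub_add_cancel_of_le (Finsupp.single_le_iff.2 (Finset.mem_Icc.1 hm).2)
    have h2 := congrArg Finsupp.degree h1
    rw [map_add, Finsupp.degree_single, hd] at h2
    omega
  have hinner : ∀ j ∈ d.support, ∑ m ∈ Finset.Icc 1 (d j),
      (-1 : ℚ) ^ (m - 1) * MvPowerSeries.coeff (d - Finsupp.single j m) (e (k - m)) =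
        if ∀ i, d i ≤ 1 then 1 else 0 := by
    intro j hj
    have hj0 : d j ≠ 0 := Finsupp.mem_support_iff.1 hj
    by_cases hoth : ∀ i, i ≠ j → d i ≤ 1
    -- The remaining monomial is squarefree only for `m = d j` or `m = d j - 1`. Both values are
    -- admissible when `d j ≥ 2`, and their opposite signs cancel; for `d j = 1` only `m = 1` is
    -- left.
    · have hc : ∀ m ∈ Finset.Icc 1 (d j),
          MvPowerSeries.coeff (d - Finsupp.single j m) (e (k - m)) =
            if d j ≤ m + 1 then 1 else 0 := by
        intro m hm
        rw [coeff_e]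
        congr 1
        simp only [hdeg j m hm, true_and, eq_iff_iff]
        constructor
        · intro h
          have := h j
          simp at this
          omega
        · intro h i
          by_cases hi : i = j
          · subst hi
            simp
            omega
          · have := hoth i hi
            rw [Finsupp.tsub_apply, Finsupp.single_eq_of_ne hi]
            omega
      rw [Finset.sum_congr rfl fun m hm => by rw [hc m hm]]
      obtain ⟨t, ht⟩ : ∃ t, d j = t + 1 := ⟨d j - 1, by omega⟩
      have hiff : (∀ i, d i ≤ 1) ↔ t = 0 := by
        constructor
        · intro h
          have := h j
          omega
        · intro h i
          by_cases hi : i = j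
          · subst hi
            omega
          · exact hoth i hi
      simp only [hiff, ht]
      rcases t with _ | t
      · simp
      · rw [Finset.sum_Icc_succ_top (by omega), Finset.sum_Icc_succ_top (by omega),
          Finset.sum_eq_zero]
        · simp [pow_succ]
        · intro m hm
          rw [Finset.mem_Icc] at hm
          rw [if_neg (by omega), mul_zero]
    · push Not at hoth
      obtain ⟨i, hij, hi⟩ := hoth
      rw [if_neg fun h => by have := h i; omega]
      refine Finset.sum_eq_zero fun m _ => ?_
      rw [coeff_e, if_neg, mul_zero]
      rintro ⟨-, h⟩
      have := h i
      rw [Finsupp.tsub_apply, Finsupp.single_eq_of_ne hij] at this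
      omega
  rw [Finset.sum_congr rfl hinner]
  by_cases h1 : ∀ i, d i ≤ 1
  · simp only [hd, h1, implies_true, and_self, if_true, Finset.sum_const, nsmul_eq_mul, mul_one]
    rw [← hd, Finsupp.degree_apply]
    rw [Finset.sum_congr rfl (g := fun _ => 1)]
    · simp
    · intro j hj
      have := h1 j
      have := Finsupp.mem_support_iff.1 hj
      omega
  · simp [h1]

theorem coeff_zero_H : PowerSeries.coeff 0 H = 1 := by
  rw [H, PowerSeries.coeff_mk]
  refine MvPowerSeries.ext fun d => ?_
  rw [coeff_h, MvPowerSeries.coeff_one]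
  simp only [Finsupp.degree_eq_zero_iff]

theorem coeff_zero_E : PowerSeries.coeff 0 E = 1 := by
  classical
  rw [E, PowerSeries.coeff_mk]
  refine MvPowerSeries.ext fun d => ?_
  rw [coeff_e, MvPowerSeries.coeff_one]
  simp only [Finsupp.degree_eq_zero_iff]
  congr 1
  simp only [eq_iff_iff, and_iff_left_iff_imp]
  rintro rfl
  simp

/-! ### Cycle-weighted permutation sums -/

section PermSum

open Equiv Equiv.Perm

variable {R : Type*} [CommRing R] {α β : Type*} [Fintype α] [DecidableEq α] [Fintype β]
  [DecidableEq β]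

/-- The product of `q k` over the lengths `k` of the cycles of `σ`, fixed points included. -/
def cycProd (q : ℕ → R) (σ : Perm α) : R := (σ.partition.parts.map q).prod

/-- The sum over all permutations `σ` of `∏ m i (σ i)` weighted by `q` on cycle lengths. -/
def permSum (α : Type*) [Fintype α] [DecidableEq α] (q : ℕ → R) (m : α → α → R) : R :=
  ∑ σ : Perm α, cycProd q σ * ∏ i, m i (σ i)

/-- The sum over all cyclically closed enumerations of `α` of the product of the `m`-weights. -/
def closedWalkSum (α : Type*) [Fintype α] [DecidableEq α] (m : α → α → R) : R :=
  ∑ v : Fin (Fintype.card α) ≃ α, ∏ j, m (v j) (v (finRotate _ j))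

theorem cycleType_permCongr (f : α ≃ β) (σ : Perm α) :
    (f.permCongr σ).cycleType = σ.cycleType := by
  rw [← cycleType_extendDomain (p := fun _ : β => True)
    (f.trans (Equiv.subtypeUnivEquiv fun _ => trivial).symm)]
  congr 1

/-- Counting fixed points as a difference makes the weight depend only on `cycleType` and the
cardinality of the type, both easy to transport. -/
theorem parts_partition_eq (σ : Perm α) : σ.partition.parts =
    σ.cycleType + Multiset.replicate (Fintype.card α - σ.cycleType.sum) 1 := by
  rw [parts_partition, sum_cycleType]

theorem cycProd_permCongr (q : ℕ → R) (f : α ≃ β) (σ : Perm α) :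
    cycProd q (f.permCongr σ) = cycProd q σ := by
  rw [cycProd, cycProd, parts_partition_eq, parts_partition_eq, cycleType_permCongr,
    Fintype.card_congr f]

theorem permSum_congr (q : ℕ → R) (f : α ≃ β) (m : β → β → R) :
    permSum α q (fun a b => m (f a) (f b)) = permSum β q m := by
  refine Fintype.sum_equiv f.permCongr _ _ fun σ => ?_
  rw [cycProd_permCongr]
  congr 1
  refine Fintype.prod_equiv f _ _ fun i => ?_
  simp [permCongr_apply]

theorem closedWalkSum_congr (f : α ≃ β) (m : β → β → R) :
    closedWalkSum α (fun a b => m (f a) (f b)) = closedWalkSum β m := by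
  have hc : Fintype.card α = Fintype.card β := Fintype.card_congr f
  unfold closedWalkSum
  rw [hc]
  exact Fintype.sum_equiv (Equiv.equivCongr (Equiv.refl _) f) _ _ fun v => rfl

theorem permSum_of_isEmpty [IsEmpty α] (q : ℕ → R) (m : α → α → R) : permSum α q m = 1 := by
  rw [permSum, Fintype.sum_unique, cycProd, parts_partition_eq]
  have : (default : Perm α) = 1 := Subsingleton.elim _ _
  simp [this]

theorem subtypeCongr_eq_mul {γ : Type*} (p : γ → Prop) [DecidablePred p]
    (c : Perm {a // p a}) (ρ : Perm {a // ¬ p a}) : c.subtypeCongr ρ = ofSubtype c * ofSubtype ρ := by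
  ext a
  rw [Perm.mul_apply]
  by_cases ha : p a
  · rw [Perm.subtypeCongr.left_apply _ _ ha, ofSubtype_apply_of_not_mem ρ (not_not.2 ha),
      ofSubtype_apply_of_mem c ha]
  · rw [Perm.subtypeCongr.right_apply _ _ ha, ofSubtype_apply_of_mem ρ ha,
      ofSubtype_apply_of_not_mem c (ρ ⟨a, ha⟩).2]

theorem cycProd_subtypeCongr (q : ℕ → R) (p : α → Prop) [DecidablePred p]
    [Fintype {a // p a}] [Fintype {a // ¬ p a}] (c : Perm {a // p a}) (ρ : Perm {a // ¬ p a}) : cycProd q (c.subtypeCongr ρ) = cycProd q c * cycProd q ρ := by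
  have hd : Perm.Disjoint (ofSubtype c) (ofSubtype ρ) := by
    intro a
    by_cases ha : p a
    · exact Or.inr (ofSubtype_apply_of_not_mem ρ (not_not.2 ha))
    · exact Or.inl (ofSubtype_apply_of_not_mem c ha)
  have hct : (c.subtypeCongr ρ).cycleType = c.cycleType + ρ.cycleType := by
    rw [subtypeCongr_eq_mul, hd.cycleType_mul, cycleType_ofSubtype, cycleType_ofSubtype]
  have h1 : c.cycleType.sum ≤ Fintype.card {a // p a} := by
    rw [sum_cycleType]; exact Finset.card_le_univ _
  have h2 : ρ.cycleType.sum ≤ Fintype.card {a // ¬ p a} := by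
    rw [sum_cycleType]; exact Finset.card_le_univ _
  have h3 : Fintype.card α = Fintype.card {a // p a} + Fintype.card {a // ¬ p a} := by
    have := Fintype.card_subtype_compl p
    have := Fintype.card_subtype_le p
    omega
  -- Fixed points add up over the two blocks; the bounds above are needed because the subtraction is
  -- truncated.
  have h4 : Fintype.card α - (c.cycleType + ρ.cycleType).sum =
      (Fintype.card {a // p a} - c.cycleType.sum) +
        (Fintype.card {a // ¬ p a} - ρ.cycleType.sum) := by
    rw [Multiset.sum_add]
    omega
  simp only [cycProd, parts_partition_eq, hct, h4, Multiset.replicate_add, Multiset.map_add,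
    Multiset.prod_add]
  ring

theorem cycProd_of_isCycleOn_univ [Nonempty α] (q : ℕ → R) {c : Perm α}
    (hc : c.IsCycleOn Set.univ) : cycProd q c = q (Fintype.card α) := by
  rw [cycProd, parts_partition_eq]
  -- On one point the cycle is the identity, whose `cycleType` is empty: the single part comes from
  -- the fixed point.
  rcases subsingleton_or_nontrivial α with h | h
  · have h1 : c = 1 := Subsingleton.elim _ _
    have h2 : Fintype.card α = 1 :=
      le_antisymm (Fintype.card_le_one_iff_subsingleton.2 h) Fintype.card_pos
    simp [h1, h2]
  · have hcyc : c.IsCycle := isCycle_iff_exists_isCycleOn.2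
      ⟨Set.univ, Set.nontrivial_univ, hc, fun _ _ => trivial⟩
    have hs : c.support = Finset.univ := by
      ext a
      simp only [mem_support, Finset.mem_univ, iff_true]
      exact hc.apply_ne Set.nontrivial_univ trivial
    simp [hcyc.cycleType, hs]

theorem finRotate_pow_zero (k : ℕ) (j : Fin (k + 1)) : (finRotate (k + 1) ^ (j : ℕ)) 0 = j := by
  obtain ⟨j, hj⟩ := j
  induction j with
  | zero => rfl
  | succ j ih =>
    have := ih (by omega)
    simp only at this ⊢
    rw [pow_succ', Perm.mul_apply, this, finRotate_of_lt (by omega)]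

open Classical in
/-- Enumerating a cyclic permutation from a starting point. -/
theorem closedWalkSum_eq [Nonempty α] (m : α → α → R) :
    closedWalkSum α m = (Fintype.card α : R) *
      ∑ c ∈ (Finset.univ : Finset (Perm α)).filter (fun c => c.IsCycleOn Set.univ),
        ∏ a, m a (c a) := by
  obtain ⟨k, hk⟩ : ∃ k, Fintype.card α = k + 1 := ⟨Fintype.card α - 1, by
    have := Fintype.card_pos (α := α); omega⟩
  have h1 : (Fintype.card α : R) *
      ∑ c ∈ (Finset.univ : Finset (Perm α)).filter (fun c => c.IsCycleOn Set.univ),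
        ∏ a, m a (c a) =
      ∑ x ∈ (Finset.univ : Finset α) ×ˢ
        (Finset.univ : Finset (Perm α)).filter (fun c => c.IsCycleOn Set.univ),
        ∏ a, m a (x.2 a) := by
    simp only [Finset.sum_product]
    rw [Finset.sum_const, Finset.card_univ, nsmul_eq_mul]
  rw [h1]
  unfold closedWalkSum
  rw [hk]
  have hpow : ∀ (v : Fin (k + 1) ≃ α) (j : Fin (k + 1)),
      (v.permCongr (finRotate (k + 1)) ^ (j : ℕ)) (v 0) = v j := by
    intro v j
    have : v.permCongr (finRotate (k + 1)) ^ (j : ℕ) =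
        v.permCongr (finRotate (k + 1) ^ (j : ℕ)) := (map_pow v.permCongrHom _ _).symm
    rw [this, permCongr_apply, symm_apply_apply, finRotate_pow_zero]
  -- An enumeration is the same as a starting point together with a cyclic permutation, read back as
  -- `j ↦ c ^ j` applied to the start. The starting points supply the factor `Fintype.card α`.
  refine Finset.sum_bij (fun v _ => (v 0, v.permCongr (finRotate (k + 1)))) ?_ ?_ ?_ ?_
  · intro v _
    simp only [Finset.mem_product, Finset.mem_univ, Finset.mem_filter, true_and]
    refine ⟨Set.bijOn_univ.2 (Equiv.bijective _), fun x _ y _ => ?_⟩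
    have key : ∀ x, (v.permCongr (finRotate (k + 1))).SameCycle (v 0) x := fun x =>
      ⟨((v.symm x : Fin (k + 1)) : ℕ), by rw [zpow_natCast, hpow, apply_symm_apply]⟩
    exact (key x).symm.trans (key y)
  · intro v _ w _ h
    ext j
    rw [Prod.mk.injEq] at h
    rw [← hpow v, ← hpow w, h.1, h.2]
  · rintro ⟨i, c⟩ hx
    simp only [Finset.mem_product, Finset.mem_univ, Finset.mem_filter, true_and] at hx
    have hx' : c.IsCycleOn ((Finset.univ : Finset α) : Set α) := by rwa [Finset.coe_univ]
    have hsurj : Function.Surjective fun j : Fin (k + 1) => (c ^ (j : ℕ)) i := by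
      intro b
      obtain ⟨r, hr, hb⟩ := hx'.exists_pow_eq (Finset.mem_univ i) (Finset.mem_univ b)
      rw [Finset.card_univ, hk] at hr
      exact ⟨⟨r, hr⟩, hb⟩
    have hbij : Function.Bijective fun j : Fin (k + 1) => (c ^ (j : ℕ)) i :=
      (Fintype.bijective_iff_surjective_and_card _).2 ⟨hsurj, by simp [hk]⟩
    refine ⟨Equiv.ofBijective _ hbij, Finset.mem_univ _, Prod.ext rfl ?_⟩
    ext a
    obtain ⟨j, rfl⟩ := (Equiv.ofBijective _ hbij).surjective a
    simp only [permCongr_apply, symm_apply_apply]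
    change (c ^ (finRotate (k + 1) j : ℕ)) i = c ((c ^ (j : ℕ)) i)
    rw [← Perm.mul_apply, ← pow_succ', coe_finRotate]
    split_ifs with hj
    · rw [hj, Fin.val_last, ← hk, ← Finset.card_univ, hx'.pow_card_apply (Finset.mem_univ i)]
      rfl
    · rfl
  · intro v _
    refine Fintype.prod_equiv v _ _ fun j => ?_
    simp [permCongr_apply]

theorem isCycleOn_subtypeCongr_iff {γ : Type*} [DecidableEq γ] (T : Finset γ) (c : Perm {a // a ∈ T})
    (ρ : Perm {a // ¬ a ∈ T}) :
    (c.subtypeCongr ρ).IsCycleOn (T : Set γ) ↔ c.IsCycleOn Set.univ := by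
  have hz : ∀ (z : ℤ) (x : {a // a ∈ T}), ((c.subtypeCongr ρ) ^ z) x.1 = ((c ^ z) x).1 := by
    intro z x
    have : (c.subtypeCongr ρ) ^ z = (c ^ z).subtypeCongr (ρ ^ z) :=
      (map_zpow (subtypeCongrHom fun a => a ∈ T) (c, ρ) z).symm
    rw [this, Perm.subtypeCongr.left_apply_subtype]
  constructor
  · intro h
    refine ⟨Set.bijOn_univ.2 (Equiv.bijective _), fun x _ y _ => ?_⟩
    obtain ⟨z, hzz⟩ := h.2 x.2 y.2
    exact ⟨z, Subtype.ext (by rw [← hz, hzz])⟩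
  · intro h
    refine ⟨Equiv.bijOn _ fun a => ?_, fun x hx y hy => ?_⟩
    · by_cases ha : a ∈ T
      · have := hz 1 ⟨a, ha⟩
        simp only [zpow_one] at this
        simp [this, ha]
      · rw [Perm.subtypeCongr.right_apply _ _ ha]
        simpa [ha] using (ρ ⟨a, ha⟩).2
    · obtain ⟨z, hzz⟩ := h.2 (Set.mem_univ (⟨x, hx⟩ : {a // a ∈ T}))
        (Set.mem_univ (⟨y, hy⟩ : {a // a ∈ T}))
      exact ⟨z, by rw [hz z ⟨x, hx⟩, hzz]⟩

open Classical in
-- A permutation with `T` as one cycle is a cyclic permutation of `T` paired with an arbitrary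
-- permutation of the complement, and both weights are multiplicative over this splitting.
theorem sum_isCycleOn (q : ℕ → R) (m : α → α → R) {T : Finset α} (hT : T.Nonempty) :
    ∑ σ ∈ (Finset.univ : Finset (Perm α)).filter (fun σ => σ.IsCycleOn (T : Set α)),
        cycProd q σ * ∏ i, m i (σ i) =
      q T.card * (∑ c ∈ (Finset.univ : Finset (Perm {a // a ∈ T})).filter
        (fun c => c.IsCycleOn Set.univ), ∏ a, m a.1 (c a).1) *
          permSum {a // ¬ a ∈ T} q (fun a b => m a.1 b.1) := by
  have : Nonempty {a // a ∈ T} := hT.to_subtype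
  rw [permSum, mul_assoc, Finset.sum_mul_sum, ← Finset.sum_product', Finset.mul_sum]
  symm
  refine Finset.sum_bij (fun x _ => x.1.subtypeCongr x.2) ?_ ?_ ?_ ?_
  · intro x hx
    simp only [Finset.mem_product, Finset.mem_univ, Finset.mem_filter, true_and, and_true] at hx ⊢
    exact (isCycleOn_subtypeCongr_iff T x.1 x.2).2 hx
  · intro x _ y _ h
    exact subtypeCongrHom_injective _ h
  · intro σ hσ
    simp only [Finset.mem_filter, Finset.mem_univ, true_and] at hσ
    have h1 : ∀ a, σ a ∈ T ↔ a ∈ T := fun a => by simpa using hσ.apply_mem_iff (x := a)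
    have h2 : (σ.subtypePerm h1).subtypeCongr
        (σ.subtypePerm (p := fun a => ¬ a ∈ T) fun a => not_congr (h1 a)) = σ := by
      ext a
      by_cases ha : a ∈ T
      · rw [Perm.subtypeCongr.left_apply _ _ ha]
        rfl
      · rw [Perm.subtypeCongr.right_apply _ _ ha]
        rfl
    refine ⟨(σ.subtypePerm h1, σ.subtypePerm fun a => not_congr (h1 a)), ?_, h2⟩
    simp only [Finset.mem_product, Finset.mem_univ, Finset.mem_filter, true_and, and_true]
    rw [← isCycleOn_subtypeCongr_iff T _ (σ.subtypePerm fun a => not_congr (h1 a)), h2]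
    exact hσ
  · rintro ⟨c, ρ⟩ hx
    simp only [Finset.mem_product, Finset.mem_univ, Finset.mem_filter, true_and, and_true] at hx
    have hp : ∏ i, m i (c.subtypeCongr ρ i) =
        (∏ a : {a // a ∈ T}, m a.1 (c a).1) * ∏ a : {a // ¬ a ∈ T}, m a.1 (ρ a).1 := by
      rw [← Fintype.prod_subtype_mul_prod_subtype fun a => a ∈ T]
      simp only [Perm.subtypeCongr.left_apply_subtype, Perm.subtypeCongr.right_apply_subtype]
      congr!
    dsimp only
    rw [cycProd_subtypeCongr, cycProd_of_isCycleOn_univ q hx, Fintype.card_coe, hp]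
    ring

/-- Splitting off the cycle through a marked point. -/
theorem card_mul_permSum {q : ℕ → R} (hq : q 0 = 0) (m : α → α → R) :
    (Fintype.card α : R) * permSum α q m =
      ∑ T : Finset α, q T.card * closedWalkSum {a // a ∈ T} (fun a b => m a.1 b.1) *
        permSum {a // ¬ a ∈ T} q (fun a b => m a.1 b.1) := by
  classical
  -- Double counting of pairs of a permutation and a marked point: the factor `T.card` inside the
  -- closed-walk sum becomes the choice of the mark in `T`. The empty set admits no mark, and its
  -- term vanishes by `q 0 = 0`.
  have hR : ∀ T : Finset α, q T.card * closedWalkSum {a // a ∈ T} (fun a b => m a.1 b.1) *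
      permSum {a // ¬ a ∈ T} q (fun a b => m a.1 b.1) =
      ∑ σ : Perm α, ∑ i : α, if i ∈ T ∧ σ.IsCycleOn (T : Set α) then
        cycProd q σ * ∏ i, m i (σ i) else 0 := by
    intro T
    rcases T.eq_empty_or_nonempty with rfl | hT
    · simp [hq]
    · have : Nonempty {a // a ∈ T} := hT.to_subtype
      rw [closedWalkSum_eq, Fintype.card_coe, mul_left_comm, mul_assoc, ← sum_isCycleOn q m hT,
        Finset.sum_filter, Finset.mul_sum]
      refine Finset.sum_congr rfl fun σ _ => ?_
      split_ifs with hσ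
      · simp [hσ]
      · simp [hσ]
  simp_rw [hR]
  rw [Finset.sum_comm, permSum, Finset.mul_sum]
  refine Finset.sum_congr rfl fun σ _ => ?_
  rw [Finset.sum_comm, ← nsmul_eq_mul, ← Finset.card_univ, ← Finset.sum_const]
  refine Finset.sum_congr rfl fun i _ => ?_
  -- Once the permutation and the mark are fixed, the only possible `T` is the cycle through the
  -- mark.
  rw [Finset.sum_eq_single (Finset.univ.filter fun a => σ.SameCycle i a), if_pos]
  · refine ⟨by simp [SameCycle.refl], Equiv.bijOn _ fun a => ?_, fun x hx y hy => ?_⟩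
    · simp
    · simp only [Finset.coe_filter, Finset.mem_univ, true_and, Set.mem_ofPred_eq] at hx hy
      exact hx.symm.trans hy
  · intro T _ hne
    rw [if_neg]
    rintro ⟨hi, hT⟩
    refine hne ?_
    ext a
    simp only [Finset.mem_filter, Finset.mem_univ, true_and]
    constructor
    · exact fun ha => hT.2 hi ha
    · rintro ⟨z, rfl⟩
      exact (hT.1.perm_zpow z).mapsTo hi
  · simp

end PermSum

/-! ### Multilinear coefficients -/

section Multilinear

variable {R : Type*} [CommRing R] {α : Type*}

/-- The exponent vector of the squarefree monomial on `S`. -/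
def ind (S : Finset α) : α →₀ ℕ := ∑ i ∈ S, Finsupp.single i 1

theorem ind_apply [DecidableEq α] (S : Finset α) (a : α) : ind S a = if a ∈ S then 1 else 0 := by
  rw [ind, Finsupp.finsetSum_apply]
  simp [Finsupp.single_apply]

theorem degree_ind (S : Finset α) : (ind S).degree = S.card := by
  rw [ind, map_sum]
  simp

theorem ind_injective : Function.Injective (ind : Finset α → α →₀ ℕ) := by
  classical
  intro S T h
  ext a
  have := DFunLike.congr_fun h a
  rw [ind_apply, ind_apply] at this
  by_cases h1 : a ∈ S <;> by_cases h2 : a ∈ T <;> simp_all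

theorem coeff_ind_mul [DecidableEq α] (S : Finset α) (f g : MvPowerSeries α R) :
    MvPowerSeries.coeff (ind S) (f * g) =
      ∑ T ∈ S.powerset, MvPowerSeries.coeff (ind (S \ T)) f * MvPowerSeries.coeff (ind T) g := by
  rw [MvPowerSeries.coeff_mul]
  symm
  refine Finset.sum_bij (fun T _ => (ind (S \ T), ind T)) ?_ ?_ ?_ ?_
  · intro T hT
    rw [Finset.HasAntidiagonal.mem_antidiagonal]
    exact Finset.sum_sdiff (Finset.mem_powerset.1 hT)
  · intro T _ T' _ h
    exact ind_injective (Prod.ext_iff.1 h).2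
  · rintro ⟨x, y⟩ hxy
    have hxy := Finset.HasAntidiagonal.mem_antidiagonal.1 hxy
    have h1 : ∀ a, x a + y a = if a ∈ S then 1 else 0 := fun a => by
      rw [← ind_apply, ← hxy, Finsupp.add_apply]
    refine ⟨y.support, ?_, ?_⟩
    · rw [Finset.mem_powerset]
      intro a ha
      have h2 := h1 a
      have h3 := Finsupp.mem_support_iff.1 ha
      by_contra h4
      rw [if_neg h4] at h2
      omega
    · refine Prod.ext ?_ ?_
      · ext a
        have h2 := h1 a
        simp only [ind_apply, Finset.mem_sdiff, Finsupp.mem_support_iff]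
        by_cases h3 : a ∈ S <;> by_cases h4 : y a = 0 <;> simp [h3, h4] at h2 ⊢ <;> omega
      · ext a
        have h2 := h1 a
        simp only [ind_apply, Finsupp.mem_support_iff]
        by_cases h3 : a ∈ S <;> by_cases h4 : y a = 0 <;> simp [h3, h4] at h2 ⊢
        omega
  · intro T _
    rfl

theorem sum_single_eq_ind_iff {ι : Type*} [Fintype ι] [DecidableEq α] (w : ι → α) (T : Finset α) :
    ∑ j, Finsupp.single (w j) 1 = ind T ↔
      Function.Injective w ∧ Finset.univ.image w = T := by
  classical
  constructor
  · intro h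
    have hc : ∀ a, (Finset.univ.filter fun j => w j = a).card = if a ∈ T then 1 else 0 := by
      intro a
      rw [← ind_apply, ← h, Finsupp.finsetSum_apply, Finset.card_filter]
      exact Finset.sum_congr rfl fun j _ => by rw [Finsupp.single_apply]
    constructor
    · intro i j hij
      have h1 : (Finset.univ.filter fun l => w l = w j).card ≤ 1 := by
        rw [hc]
        split_ifs <;> simp
      exact Finset.card_le_one.1 h1 i (by simp [hij]) j (by simp)
    · ext a
      have h2 := hc a
      constructor
      · intro ha
        obtain ⟨j, -, rfl⟩ := Finset.mem_image.1 ha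
        by_contra hT
        rw [if_neg hT, Finset.card_eq_zero] at h2
        exact Finset.notMem_empty j (h2 ▸ by simp)
      · intro ha
        rw [if_pos ha] at h2
        obtain ⟨j, hj⟩ := Finset.card_pos.1 (h2 ▸ zero_lt_one)
        exact Finset.mem_image.2 ⟨j, Finset.mem_univ _, (Finset.mem_filter.1 hj).2⟩
  · rintro ⟨h1, rfl⟩
    rw [ind, Finset.sum_image fun i _ j _ h => h1 h]

theorem prod_X_mul_C {ι : Type*} (s : Finset ι) (w : ι → α) (r : ι → R) :
    ∏ j ∈ s, ((MvPowerSeries.X (w j) : MvPowerSeries α R) * MvPowerSeries.C (r j)) =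
      MvPowerSeries.monomial (∑ j ∈ s, Finsupp.single (w j) 1) (∏ j ∈ s, r j) := by
  classical
  induction s using Finset.induction_on with
  | empty => simp
  | insert a s ha ih =>
    rw [Finset.prod_insert ha, ih, Finset.sum_insert ha, Finset.prod_insert ha, MvPowerSeries.X,
      ← MvPowerSeries.monomial_zero_eq_C_apply, MvPowerSeries.monomial_mul_monomial,
      MvPowerSeries.monomial_mul_monomial, one_mul, add_zero]

end Multilinear

/-! ### Powers of matrices as sums over walks -/

section Walks

variable {R : Type*} [CommRing R] {α : Type*} [Fintype α] [DecidableEq α]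

theorem pow_succ_apply_eq_sum (P : Matrix α α R) (k : ℕ) (a b : α) :
    (P ^ (k + 1)) a b = ∑ v : Fin k → α, ∏ j : Fin (k + 1),
      P ((Fin.cons a v : Fin (k + 1) → α) j) ((Fin.snoc v b : Fin (k + 1) → α) j) := by
  induction k generalizing a with
  | zero => simp [Fin.snoc]
  | succ k ih =>
    rw [pow_succ', Matrix.mul_apply, ← Fintype.sum_equiv (Fin.consEquiv fun _ => α)
      (fun x : α × (Fin k → α) => P a x.1 * ∏ j : Fin (k + 1),
        P ((Fin.cons x.1 x.2 : Fin (k + 1) → α) j) ((Fin.snoc x.2 b : Fin (k + 1) → α) j)),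
      Fintype.sum_prod_type]
    · refine Finset.sum_congr rfl fun c _ => ?_
      rw [ih, Finset.mul_sum]
    · rintro ⟨c, v⟩
      conv_rhs => rw [Fin.prod_univ_succ]
      have h : (Fin.snoc (Fin.cons c v : Fin (k + 1) → α) b : Fin (k + 2) → α) =
          Fin.cons c (Fin.snoc v b : Fin (k + 1) → α) :=
        (Fin.cons_snoc_eq_snoc_cons c v b).symm
      change _ = P ((Fin.cons a (Fin.cons c v : Fin (k + 1) → α) : Fin (k + 2) → α) 0)
        ((Fin.snoc (Fin.cons c v : Fin (k + 1) → α) b : Fin (k + 2) → α) 0) *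
        ∏ j : Fin (k + 1), P ((Fin.cons a (Fin.cons c v : Fin (k + 1) → α) : Fin (k + 2) → α) j.succ)
        ((Fin.snoc (Fin.cons c v : Fin (k + 1) → α) b : Fin (k + 2) → α) j.succ)
      rw [h]
      simp only [Fin.cons_zero, Fin.cons_succ]

/-- For a walk that returns to its start, the list of endpoints is the list of starting points
rotated by one. -/
theorem trace_pow_succ_eq_sum (P : Matrix α α R) (k : ℕ) :
    (P ^ (k + 1)).trace = ∑ w : Fin (k + 1) → α, ∏ j, P (w j) (w (finRotate _ j)) := by
  rw [Matrix.trace, ← Fintype.sum_equiv (Fin.consEquiv fun _ => α)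
      (fun x : α × (Fin k → α) => ∏ j : Fin (k + 1),
        P ((Fin.cons x.1 x.2 : Fin (k + 1) → α) j)
          ((Fin.cons x.1 x.2 : Fin (k + 1) → α) (finRotate _ j))) _ fun _ => rfl,
      Fintype.sum_prod_type]
  refine Finset.sum_congr rfl fun a _ => ?_
  rw [Matrix.diag_apply, pow_succ_apply_eq_sum]
  simp_rw [Fin.snoc_eq_cons_rotate]

theorem closedWalkSum_eq_of_card (m : α → α → R) {k : ℕ} (hk : Fintype.card α = k) :
    closedWalkSum α m = ∑ v : Fin k ≃ α, ∏ j, m (v j) (v (finRotate _ j)) := by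
  subst hk
  rfl

/-- The matrix with entries `x_i m_ij`. -/
def weightMatrix {β : Type*} (m : β → β → R) : Matrix β β (MvPowerSeries β R) :=
  Matrix.of fun i j => MvPowerSeries.X i * MvPowerSeries.C (m i j)

theorem homog_weightMatrix {β : Type*} (m : β → β → R) (i j : β) : Homog 1 (weightMatrix m i j) :=
  (homog_X i).mul (homog_C _)

/-- A closed walk carries one variable per step, so its monomial is the squarefree one on `T`
exactly when it visits each point of `T` once. -/
theorem coeff_ind_trace_pow (m : α → α → R) {T : Finset α} (hT : T.Nonempty) :
    MvPowerSeries.coeff (ind T) ((weightMatrix m) ^ T.card).trace =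
      closedWalkSum {a // a ∈ T} fun a b => m a.1 b.1 := by
  obtain ⟨k, hk⟩ : ∃ k, T.card = k + 1 := ⟨T.card - 1, by have := hT.card_pos; omega⟩
  rw [hk, trace_pow_succ_eq_sum, closedWalkSum_eq_of_card _ ((Fintype.card_coe T).trans hk), map_sum]
  have h1 : ∀ w : Fin (k + 1) → α, MvPowerSeries.coeff (ind T)
      (∏ j, weightMatrix m (w j) (w (finRotate _ j))) =
      if Function.Injective w ∧ Finset.univ.image w = T then
        ∏ j, m (w j) (w (finRotate _ j)) else 0 := by
    intro w
    have : ∏ j, weightMatrix m (w j) (w (finRotate _ j)) = _ :=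
      prod_X_mul_C Finset.univ w fun j => m (w j) (w (finRotate _ j))
    rw [this, MvPowerSeries.coeff_monomial]
    congr 1
    rw [eq_iff_iff, eq_comm, sum_single_eq_ind_iff]
  simp_rw [h1]
  rw [← Finset.sum_filter]
  symm
  refine Finset.sum_bij (fun v _ j => (v j).1) ?_ ?_ ?_ ?_
  · intro v _
    simp only [Finset.mem_filter, Finset.mem_univ, true_and]
    refine ⟨fun i j h => v.injective (Subtype.ext h), ?_⟩
    ext a
    simp only [Finset.mem_image, Finset.mem_univ, true_and]
    constructor
    · rintro ⟨j, rfl⟩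
      exact (v j).2
    · intro ha
      exact ⟨v.symm ⟨a, ha⟩, by simp⟩
  · intro v _ v' _ h
    ext j
    exact congrFun h j
  · intro w hw
    simp only [Finset.mem_filter, Finset.mem_univ, true_and] at hw
    obtain ⟨hinj, rfl⟩ := hw
    refine ⟨Equiv.ofBijective
      (fun j => ⟨w j, Finset.mem_image_of_mem w (Finset.mem_univ j)⟩) ⟨?_, ?_⟩,
      Finset.mem_univ _, rfl⟩
    · intro i j h
      exact hinj (congrArg Subtype.val h)
    · rintro ⟨a, ha⟩
      obtain ⟨j, -, rfl⟩ := Finset.mem_image.1 ha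
      exact ⟨j, rfl⟩
  · intro v _
    rfl

/-- The multilinear coefficients of the series with logarithmic Euler derivative
`∑ k, q k * tr (M ^ k)` are cycle-weighted permutation sums. -/
theorem coeff_ind_eq_permSum [Algebra ℚ R] {q : ℕ → R} (hq : q 0 = 0) (m : α → α → R)
    {y : MvPowerSeries α R} (hy : euler α R y = y * traceSeries q (weightMatrix m))
    (h0 : MvPowerSeries.constantCoeff y = 1) (S : Finset α) :
    MvPowerSeries.coeff (ind S) y = permSum {a // a ∈ S} q fun a b => m a.1 b.1 := by
  have := IsAddTorsionFree.of_module_rat R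
  induction S using Finset.strongInduction with
  | H S ih =>
    rcases S.eq_empty_or_nonempty with rfl | hS
    · rw [permSum_of_isEmpty]
      exact h0
    have h1 := congrArg (MvPowerSeries.coeff (ind S)) hy
    rw [coeff_euler, degree_ind, coeff_ind_mul] at h1
    have h2 := card_mul_permSum hq (α := {a // a ∈ S}) fun a b => m a.1 b.1
    rw [Fintype.card_coe, ← nsmul_eq_mul] at h2
    -- The Euler equation at this monomial and `card_mul_permSum` are the same recursion, each with
    -- the factor `S.card`, which is cancelled here; nonempty `T` leaves a smaller set for the
    -- induction.
    refine (nsmul_right_injective hS.card_pos.ne') ?_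
    dsimp only
    rw [h1, h2]
    symm
    refine Finset.sum_bij (fun T _ => T.map (Function.Embedding.subtype _)) ?_ ?_ ?_ ?_
    · intro T _
      rw [Finset.mem_powerset]
      intro a ha
      obtain ⟨b, -, rfl⟩ := Finset.mem_map.1 ha
      exact b.2
    · intro T _ T' _ h
      exact Finset.map_injective _ h
    · intro T hT
      refine ⟨T.subtype (· ∈ S), Finset.mem_univ _, ?_⟩
      exact Finset.subtype_map_of_mem fun a ha => Finset.mem_powerset.1 hT ha
    · intro T _
      rcases T.eq_empty_or_nonempty with rfl | hT
      · simp [coeff_traceSeries, degree_ind, hq]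
      have hT' : (T.map (Function.Embedding.subtype (· ∈ S))).Nonempty := hT.map
      set T' := T.map (Function.Embedding.subtype (· ∈ S)) with hTdef
      have hsub : T' ⊆ S := by
        intro a ha
        obtain ⟨b, -, rfl⟩ := Finset.mem_map.1 ha
        exact b.2
      rw [coeff_traceSeries, degree_ind, coeff_ind_trace_pow m hT',
        ih (S \ T') (Finset.sdiff_ssubset hsub hT'), mul_comm (permSum _ _ _), hTdef,
        Finset.card_map]
      have hmem : ∀ a : {a // a ∈ S}, a ∈ T ↔ a.1 ∈ T' := fun a =>
        (Finset.mem_map' (Function.Embedding.subtype (· ∈ S))).symm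
      congr 1
      · congr 1
        let f : {a // a ∈ T} ≃ {a // a ∈ T'} :=
          { toFun := fun a => ⟨a.1.1, (hmem a.1).1 a.2⟩
            invFun := fun a => ⟨⟨a.1, hsub a.2⟩, (hmem _).2 a.2⟩
            left_inv := fun a => rfl
            right_inv := fun a => rfl }
        exact closedWalkSum_congr f fun a b => m a.1 b.1
      · let f : {a // ¬ a ∈ T} ≃ {a // a ∈ S \ T'} :=
          { toFun := fun a => ⟨a.1.1, Finset.mem_sdiff.2 ⟨a.1.2, fun h => a.2 ((hmem a.1).2 h)⟩⟩
            invFun := fun a => ⟨⟨a.1, (Finset.mem_sdiff.1 a.2).1⟩, fun h =>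
              (Finset.mem_sdiff.1 a.2).2 ((hmem _).1 h)⟩
            left_inv := fun a => rfl
            right_inv := fun a => rfl }
        exact permSum_congr q f fun a b => m a.1 b.1

end Walks

/-! ### The master formula for linear coefficients -/

section Master

variable {R : Type*} [CommRing R] [Algebra ℚ R] {α : Type*} [Fintype α] [DecidableEq α]

/-- The series `∑ k, (q k / k) * tr (M ^ k)`, whose Euler derivative is `traceSeries q M`. -/
def tracePotential (q : ℕ → R) (M : Matrix α α (MvPowerSeries α R)) : MvPowerSeries α R :=
  fun d => (1 / (d.degree : ℚ)) • (q d.degree * MvPowerSeries.coeff d (M ^ d.degree).trace)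

theorem coeff_tracePotential (q : ℕ → R) (M : Matrix α α (MvPowerSeries α R)) (d : α →₀ ℕ) :
    MvPowerSeries.coeff d (tracePotential q M) =
      (1 / (d.degree : ℚ)) • (q d.degree * MvPowerSeries.coeff d (M ^ d.degree).trace) := rfl

theorem constantCoeff_tracePotential (q : ℕ → R) (M : Matrix α α (MvPowerSeries α R)) :
    MvPowerSeries.constantCoeff (tracePotential q M) = 0 := by
  rw [← MvPowerSeries.coeff_zero_eq_constantCoeff_apply, coeff_tracePotential]
  simp

theorem euler_tracePotential {q : ℕ → R} (hq : q 0 = 0) (M : Matrix α α (MvPowerSeries α R)) :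
    euler α R (tracePotential q M) = traceSeries q M := by
  ext d
  rw [coeff_euler, coeff_tracePotential, coeff_traceSeries, ← Nat.cast_smul_eq_nsmul ℚ, smul_smul]
  by_cases hd : d.degree = 0
  · simp [hd, hq]
  · have : (d.degree : ℚ) ≠ 0 := by exact_mod_cast hd
    rw [mul_one_div_cancel this, one_smul]

/-- By uniqueness `y` factors into one series for each summand of its logarithmic derivative;
extracting the squarefree monomial distributes the variables between the two factors. -/
theorem coeff_ind_univ_eq_sum {q q' : ℕ → R} (hq : q 0 = 0) (hq' : q' 0 = 0) (m m' : α → α → R)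
    {y : MvPowerSeries α R}
    (hy : euler α R y = y * (traceSeries q (weightMatrix m) + traceSeries q' (weightMatrix m')))
    (h0 : MvPowerSeries.constantCoeff y = 1) :
    MvPowerSeries.coeff (ind Finset.univ) y = ∑ I : Finset α,
      permSum {a // a ∈ Iᶜ} q (fun a b => m a.1 b.1) *
        permSum {a // a ∈ I} q' (fun a b => m' a.1 b.1) := by
  have hexp : ∀ {q : ℕ → R} (_ : q 0 = 0) (m : α → α → R), ∃ z : MvPowerSeries α R,
      euler α R z = z * traceSeries q (weightMatrix m) ∧ MvPowerSeries.constantCoeff z = 1 :=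
    fun {q} hq m => ⟨_, by rw [euler_subst_exp (constantCoeff_tracePotential q (weightMatrix m)),
      euler_tracePotential hq], constantCoeff_subst_exp (constantCoeff_tracePotential q _)⟩
  obtain ⟨z, hz, hz0⟩ := hexp hq m
  obtain ⟨z', hz', hz0'⟩ := hexp hq' m'
  have hyz : y = z * z' := by
    refine eq_of_euler_eq_mul ?_ hy ?_ ?_
    · rw [map_add, constantCoeff_traceSeries hq, constantCoeff_traceSeries hq', add_zero]
    · rw [Derivation.leibniz, hz, hz', smul_eq_mul, smul_eq_mul]
      ring
    · rw [h0, map_mul, hz0, hz0', one_mul]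
  rw [hyz, coeff_ind_mul, Finset.powerset_univ]
  refine Finset.sum_congr rfl fun I _ => ?_
  rw [coeff_ind_eq_permSum hq m hz hz0, coeff_ind_eq_permSum hq' m' hz' hz0',
    ← Finset.compl_eq_univ_sdiff]

end Master

/-! ### The transfer matrix of coloured words -/

section Transfer

variable {A : Type*} [CommRing A] {γ : Type*} [Fintype γ] [DecidableEq γ]

theorem pow_mulVec_eq_sum (x : γ → A) (r : Matrix γ γ A) (k : ℕ) (a : γ) :
    (((Matrix.diagonal x * r) ^ k).mulVec x) a = ∑ v : Fin k → γ,
      (∏ j, x ((Fin.cons a v : Fin (k + 1) → γ) j)) *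
        ∏ j : Fin k, r ((Fin.cons a v : Fin (k + 1) → γ) j.castSucc)
          ((Fin.cons a v : Fin (k + 1) → γ) j.succ) := by
  induction k generalizing a with
  | zero => simp
  | succ k ih =>
    rw [pow_succ', ← Matrix.mulVec_mulVec, Matrix.mulVec, dotProduct,
      ← Fintype.sum_equiv (Fin.consEquiv fun _ => γ)
      (fun y : γ × (Fin k → γ) => x a * r a y.1 *
        ((∏ j, x ((Fin.cons y.1 y.2 : Fin (k + 1) → γ) j)) *
        ∏ j : Fin k, r ((Fin.cons y.1 y.2 : Fin (k + 1) → γ) j.castSucc)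
          ((Fin.cons y.1 y.2 : Fin (k + 1) → γ) j.succ))),
      Fintype.sum_prod_type]
    · refine Finset.sum_congr rfl fun b _ => ?_
      rw [ih, Finset.mul_sum, Matrix.diagonal_mul]
    · rintro ⟨b, v⟩
      refine Eq.trans ?_ (congrArg₂ (· * ·) (Fin.prod_univ_succ _) (Fin.prod_univ_succ _)).symm
      change _ = x a * (∏ j, x ((Fin.cons b v : Fin (k + 1) → γ) j)) *
        (r a b * ∏ j : Fin k, r ((Fin.cons b v : Fin (k + 1) → γ) j.castSucc)
          ((Fin.cons b v : Fin (k + 1) → γ) j.succ))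
      ring

theorem sum_pow_mulVec (x : γ → A) (r : Matrix γ γ A) (k : ℕ) :
    ∑ a, (((Matrix.diagonal x * r) ^ k).mulVec x) a = ∑ w : Fin (k + 1) → γ,
      (∏ j, x (w j)) * ∏ j : Fin k, r (w j.castSucc) (w j.succ) := by
  rw [← Fintype.sum_equiv (Fin.consEquiv fun _ => γ)
      (fun y : γ × (Fin k → γ) => (∏ j, x ((Fin.cons y.1 y.2 : Fin (k + 1) → γ) j)) *
        ∏ j : Fin k, r ((Fin.cons y.1 y.2 : Fin (k + 1) → γ) j.castSucc)
          ((Fin.cons y.1 y.2 : Fin (k + 1) → γ) j.succ)) _ fun _ => rfl,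
      Fintype.sum_prod_type]
  exact Finset.sum_congr rfl fun a _ => pow_mulVec_eq_sum x r k a

/-- The matrix determinant lemma for the complement of a transfer matrix. -/
theorem det_one_add_diagonal_mul_compl (x : γ → A) (r : Matrix γ γ A)
    (hu : IsUnit (1 - Matrix.diagonal x * r).det) :
    (1 + Matrix.diagonal x * (Matrix.of (fun _ _ => 1) - r)).det =
      (1 - Matrix.diagonal x * r).det *
        (1 + ∑ a, ((1 - Matrix.diagonal x * r)⁻¹.mulVec x) a) := by
  have h1 : 1 + Matrix.diagonal x * (Matrix.of (fun _ _ => 1) - r) =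
      (1 - Matrix.diagonal x * r) +
        Matrix.replicateCol Unit x * Matrix.replicateRow Unit (fun _ : γ => (1 : A)) := by
    ext a b
    simp [Matrix.mul_apply, Matrix.diagonal_apply, mul_sub]
    ring
  rw [h1, Matrix.det_add_replicateCol_mul_replicateRow hu]
  congr 1
  rw [Matrix.mul_assoc, ← Matrix.replicateCol_mulVec, Matrix.det_unique, Matrix.add_apply,
    Matrix.one_apply_eq, Matrix.replicateRow_mul_replicateCol_apply]
  simp [dotProduct]

/-- A finite geometric sum with remainder suffices: the remainder will have too large a degree to
affect the linear coefficient. -/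
theorem inv_one_sub_eq (K : Matrix γ γ A) (hu : IsUnit (1 - K).det) (k : ℕ) :
    (1 - K)⁻¹ = ∑ i ∈ Finset.range k, K ^ i + (1 - K)⁻¹ * K ^ k := by
  have h1 : (1 - K) * ∑ i ∈ Finset.range k, K ^ i = 1 - K ^ k := mul_neg_geom_sum K k
  have h2 : ∑ i ∈ Finset.range k, K ^ i = (1 - K)⁻¹ * (1 - K ^ k) := by
    rw [← h1, Matrix.nonsing_inv_mul_cancel_left _ _ hu]
  rw [h2, ← mul_add, sub_add_cancel, mul_one]

end Transfer

/-! ### The Rédei–Berge function in finitely many variables -/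

section FiniteColours

variable {n : ℕ}

theorem XA_eq_weightMatrix (D : Digraph (Fin n)) : XA D = weightMatrix (adj ZSeries D) := by
  classical
  ext1 i j
  rw [XA, Matrix.diagonal_mul]
  change _ = MvPowerSeries.X i * MvPowerSeries.C (adj ZSeries D i j)
  congr 1
  simp only [adj, Matrix.of_apply]
  split_ifs <;> simp

/-- Colourings compatible with a word: weakly increasing, and strictly at descents. -/
def Compatible (D : Digraph (Fin n)) (π : Equiv.Perm (Fin n)) (s : Fin n → ℕ) : Prop :=
  Monotone s ∧ ∀ (j : ℕ) (hj : j + 1 < n), j ∈ descents D π → s ⟨j, by omega⟩ < s ⟨j + 1, hj⟩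

open Classical in
/-- The Rédei–Berge function restricted to the variables `z_0, …, z_(N-1)`. -/
def finiteU (N : ℕ) (D : Digraph (Fin n)) : ZSeries :=
  ∑ π : Equiv.Perm (Fin n), ∑ s : Fin n → Fin N,
    if Compatible D π (fun j => (s j : ℕ)) then ∏ j, MvPowerSeries.X (s j : ℕ) else 0

/-- Power sums in `z_0, …, z_(N-1)`. -/
def finitePowerSum (N k : ℕ) : ZSeries :=
  if k = 0 then 0 else ∑ j : Fin N, (MvPowerSeries.X (j : ℕ)) ^ k

/-- Signed power sums in `z_0, …, z_(N-1)`. -/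
def finiteSignedPowerSum (N k : ℕ) : ZSeries :=
  if k = 0 then 0 else (-1) ^ (k - 1) * ∑ j : Fin N, (MvPowerSeries.X (j : ℕ)) ^ k

open Classical in
/-- The transfer matrix: the colour increases, or it is constant along a non-edge of `D`. -/
def transfer (R : Type*) [CommRing R] (N : ℕ) (D : Digraph (Fin n)) :
    Matrix (Fin n × Fin N) (Fin n × Fin N) R :=
  Matrix.of fun a b => if a.2 < b.2 ∨ (a.2 = b.2 ∧ ¬ D.Adj a.1 b.1) then 1 else 0

/-- The weight `x_v z_j` of the letter `v` in colour `j`. -/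
def letter (n N : ℕ) (a : Fin n × Fin N) : XSeries n :=
  MvPowerSeries.X a.1 * MvPowerSeries.C (MvPowerSeries.X (a.2 : ℕ))

theorem transfer_eq_C (N : ℕ) (D : Digraph (Fin n)) (a b : Fin n × Fin N) :
    transfer (XSeries n) N D a b = MvPowerSeries.C (transfer ZSeries N D a b) := by
  simp only [transfer, Matrix.of_apply]
  split_ifs <;> simp

/-- No transition lowers the colour, so the matrix is block triangular by colour. Inside one colour,
transitions are the non-edges of `D`. -/
theorem det_one_sub_transfer (N : ℕ) (D : Digraph (Fin n)) :
    (1 - Matrix.diagonal (letter n N) * transfer (XSeries n) N D).det =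
      ∏ j : Fin N, (1 + (MvPowerSeries.C (-MvPowerSeries.X (j : ℕ)) : XSeries n) • XA Dᶜ).det := by
  classical
  have hb : Matrix.BlockTriangular
      (1 - Matrix.diagonal (letter n N) * transfer (XSeries n) N D) Prod.snd := by
    intro a b hab
    have h1 : a ≠ b := fun h => by simp [h] at hab
    rw [Matrix.sub_apply, Matrix.one_apply_ne h1, Matrix.diagonal_mul, transfer, Matrix.of_apply,
      if_neg, mul_zero, sub_zero]
    rintro (h | h)
    · exact lt_asymm h hab
    · exact hab.ne h.1.symm
  rw [hb.det_fintype]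
  refine Finset.prod_congr rfl fun j _ => ?_
  let f : Fin n ≃ {a : Fin n × Fin N // a.2 = j} :=
    { toFun := fun v => ⟨(v, j), rfl⟩
      invFun := fun a => a.1.1
      left_inv := fun _ => rfl
      right_inv := fun a => Subtype.ext (Prod.ext rfl a.2.symm) }
  rw [← Matrix.det_submatrix_equiv_self f]
  congr 1
  ext1 v w
  have h1 : ((f v).1 = (f w).1) ↔ v = w := by simp [f]
  simp only [Matrix.submatrix_apply, Matrix.toSquareBlock_def, Matrix.of_apply, Matrix.sub_apply,
    Matrix.add_apply, Matrix.smul_apply, Matrix.one_apply, h1, Matrix.diagonal_mul, XA, transfer,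
    adj, letter, Digraph.compl_adj, smul_eq_mul, map_neg]
  simp only [f, Equiv.coe_fn_mk, lt_irrefl, false_or, true_and]
  ring

/-- Complementing kills the colour-increasing transitions, so triangularity holds in the other
direction, and the diagonal blocks now carry the edges of `D`. -/
theorem det_one_add_transfer_compl (N : ℕ) (D : Digraph (Fin n)) :
    (1 + Matrix.diagonal (letter n N) *
        (Matrix.of (fun _ _ => 1) - transfer (XSeries n) N D)).det =
      ∏ j : Fin N, (1 + (MvPowerSeries.C (MvPowerSeries.X (j : ℕ)) : XSeries n) • XA D).det := by
  classical
  have hb : Matrix.BlockTriangular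
      (1 + Matrix.diagonal (letter n N) *
        (Matrix.of (fun _ _ => 1) - transfer (XSeries n) N D)).transpose Prod.snd := by
    intro a b hab
    have h1 : b ≠ a := fun h => by simp [h] at hab
    rw [Matrix.transpose_apply, Matrix.add_apply, Matrix.one_apply_ne h1, Matrix.diagonal_mul,
      Matrix.sub_apply, transfer, Matrix.of_apply, Matrix.of_apply, if_pos (Or.inl hab), sub_self,
      mul_zero, add_zero]
  rw [← Matrix.det_transpose, hb.det_fintype]
  refine Finset.prod_congr rfl fun j _ => ?_
  let f : Fin n ≃ {a : Fin n × Fin N // a.2 = j} :=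
    { toFun := fun v => ⟨(v, j), rfl⟩
      invFun := fun a => a.1.1
      left_inv := fun _ => rfl
      right_inv := fun a => Subtype.ext (Prod.ext rfl a.2.symm) }
  rw [← Matrix.det_submatrix_equiv_self f, ← Matrix.det_transpose]
  congr 1
  ext1 v w
  have h1 : ((f v).1 = (f w).1) ↔ v = w := by simp [f]
  simp only [Matrix.transpose_apply, Matrix.submatrix_apply, Matrix.toSquareBlock_def,
    Matrix.of_apply, Matrix.sub_apply,
    Matrix.add_apply, Matrix.smul_apply, Matrix.one_apply, h1, Matrix.diagonal_mul, XA, transfer,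
    adj, letter, smul_eq_mul]
  simp only [f, Equiv.coe_fn_mk, lt_irrefl, false_or, true_and]
  split_ifs <;> ring

/-- This is `euler_det_evalMatrix` for `f = 1 + c t`, where `t f' / f = ∑ (-1)^(k-1) c^k t^k` over
`k ≥ 1`. -/
theorem euler_det_one_add_smul (D : Digraph (Fin n)) (c : ZSeries) :
    euler (Fin n) ZSeries (1 + (MvPowerSeries.C c : XSeries n) • XA D).det =
      (1 + (MvPowerSeries.C c : XSeries n) • XA D).det *
        traceSeries (fun k => if k = 0 then 0 else (-1) ^ (k - 1) * c ^ k) (XA D) := by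
  have hM : ∀ i j, Homog 1 (XA D i j) := by
    rw [XA_eq_weightMatrix]
    exact homog_weightMatrix _
  rw [← evalMatrix_linear hM]
  refine euler_det_evalMatrix hM fun k => ?_
  rw [add_mul, one_mul, mul_assoc, map_add, map_add, PowerSeries.coeff_C_mul,
    PowerSeries.coeff_C_mul, PowerSeries.coeff_mk, PowerSeries.coeff_one, PowerSeries.coeff_X]
  rcases k with _ | _ | k
  · simp
  · rw [PowerSeries.coeff_succ_X_mul]
    simp
  · rw [PowerSeries.coeff_succ_X_mul]
    simp [pow_succ]
    ring

theorem constantCoeff_det_one_add_smul (D : Digraph (Fin n)) (c : ZSeries) :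
    MvPowerSeries.constantCoeff (1 + (MvPowerSeries.C c : XSeries n) • XA D).det = 1 := by
  have hM : ∀ i j, Homog 1 (XA D i j) := by
    rw [XA_eq_weightMatrix]
    exact homog_weightMatrix _
  rw [← evalMatrix_linear hM]
  refine constantCoeff_det_evalMatrix hM ?_
  simp

theorem euler_prod {σ R ι : Type*} [CommRing R] (s : Finset ι) {y k : ι → MvPowerSeries σ R}
    (h : ∀ i ∈ s, euler σ R (y i) = y i * k i) :
    euler σ R (∏ i ∈ s, y i) = (∏ i ∈ s, y i) * ∑ i ∈ s, k i := by
  classical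
  induction s using Finset.induction_on with
  | empty => simp
  | insert a s ha ih =>
    rw [Finset.prod_insert ha, Derivation.leibniz, h a (Finset.mem_insert_self _ _),
      ih fun i hi => h i (Finset.mem_insert_of_mem hi), Finset.sum_insert ha, smul_eq_mul,
      smul_eq_mul]
    ring

theorem euler_eq_of_mul_eq_one {σ R : Type*} [CommRing R] {u v k : MvPowerSeries σ R}
    (hu : euler σ R u = u * k) (huv : u * v = 1) : euler σ R v = v * -k := by
  have h1 : u * euler σ R v + v * (u * k) = 0 := by
    rw [← hu, ← smul_eq_mul, ← smul_eq_mul, ← Derivation.leibniz, huv, Derivation.map_one_eq_zero]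
  calc euler σ R v = (u * v) * euler σ R v := by rw [huv, one_mul]
    _ = v * (u * euler σ R v) := by ring
    _ = v * -(v * (u * k)) := by rw [eq_neg_of_add_eq_zero_left h1]
    _ = v * -((u * v) * k) := by ring
    _ = v * -k := by rw [huv, one_mul]

theorem traceSeries_sum {σ R ι κ : Type*} [CommRing R] [Fintype ι] [DecidableEq ι] (s : Finset κ)
    (q : κ → ℕ → R) (M : Matrix ι ι (MvPowerSeries σ R)) :
    ∑ j ∈ s, traceSeries (q j) M = traceSeries (fun k => ∑ j ∈ s, q j k) M := by
  ext d
  rw [map_sum, coeff_traceSeries, Finset.sum_mul]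
  rfl

theorem traceSeries_neg {σ R ι : Type*} [CommRing R] [Fintype ι] [DecidableEq ι]
    (q : ℕ → R) (M : Matrix ι ι (MvPowerSeries σ R)) :
    -traceSeries q M = traceSeries (fun k => -q k) M := by
  ext d
  rw [map_neg, coeff_traceSeries, coeff_traceSeries, neg_mul]

theorem exists_inverse_det_one_sub_transfer (N : ℕ) (D : Digraph (Fin n)) :
    ∃ v : XSeries n, (1 - Matrix.diagonal (letter n N) * transfer (XSeries n) N D).det * v = 1 := by
  have h1 : MvPowerSeries.constantCoeff
      (1 - Matrix.diagonal (letter n N) * transfer (XSeries n) N D).det = 1 := by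
    rw [det_one_sub_transfer, map_prod]
    exact Finset.prod_eq_one fun j _ => constantCoeff_det_one_add_smul _ _
  have h2 : IsUnit (1 - Matrix.diagonal (letter n N) * transfer (XSeries n) N D).det := by
    rw [MvPowerSeries.isUnit_iff_constantCoeff, h1]
    exact isUnit_one
  exact h2.exists_right_inv

theorem linCoeff_transfer (N : ℕ) (D : Digraph (Fin n)) {v : XSeries n}
    (hv : (1 - Matrix.diagonal (letter n N) * transfer (XSeries n) N D).det * v = 1) :
    linCoeff ((1 + Matrix.diagonal (letter n N) *
        (Matrix.of (fun _ _ => 1) - transfer (XSeries n) N D)).det * v) =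
      ∑ I : Finset (Fin n),
        permSum {a // a ∈ Iᶜ} (finitePowerSum N) (fun a b => adj ZSeries Dᶜ a.1 b.1) *
          permSum {a // a ∈ I} (finiteSignedPowerSum N) (fun a b => adj ZSeries D a.1 b.1) := by
  refine coeff_ind_univ_eq_sum (by simp [finitePowerSum]) (by simp [finiteSignedPowerSum]) _ _ ?_ ?_
  · have h1 := euler_prod (Finset.univ : Finset (Fin N)) fun j _ =>
      euler_det_one_add_smul Dᶜ (-MvPowerSeries.X (j : ℕ))
    rw [← det_one_sub_transfer, traceSeries_sum] at h1
    have h2 := euler_prod (Finset.univ : Finset (Fin N)) fun j _ =>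
      euler_det_one_add_smul D (MvPowerSeries.X (j : ℕ))
    rw [← det_one_add_transfer_compl, traceSeries_sum] at h2
    rw [Derivation.leibniz, h2, euler_eq_of_mul_eq_one h1 hv, traceSeries_neg, smul_eq_mul,
      smul_eq_mul, ← XA_eq_weightMatrix, ← XA_eq_weightMatrix]
    -- One sign comes from inverting the determinant and the others from the argument `-z_j`;
    -- together they cancel.
    have h3 : (fun k => -∑ j : Fin N, if k = 0 then (0 : ZSeries) else
        (-1) ^ (k - 1) * (-MvPowerSeries.X (j : ℕ)) ^ k) = finitePowerSum N := by
      funext k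
      rw [finitePowerSum]
      rcases k with _ | k
      · simp
      · rw [if_neg k.succ_ne_zero, ← Finset.sum_neg_distrib]
        refine Finset.sum_congr rfl fun j _ => ?_
        rw [if_neg k.succ_ne_zero, Nat.add_sub_cancel, neg_pow (MvPowerSeries.X _), ← mul_assoc,
          ← pow_add, show k + (k + 1) = 2 * k + 1 by omega, pow_succ, pow_mul]
        simp
    have h4 : (fun k => ∑ j : Fin N, if k = 0 then (0 : ZSeries) else
        (-1) ^ (k - 1) * (MvPowerSeries.X (j : ℕ)) ^ k) = finiteSignedPowerSum N := by
      funext k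
      rw [finiteSignedPowerSum]
      split_ifs
      · simp
      · rw [Finset.mul_sum]
    rw [h3, h4]
    ring
  · have h1 := congrArg MvPowerSeries.constantCoeff hv
    rw [map_mul, det_one_sub_transfer, map_prod,
      Finset.prod_eq_one fun j _ => constantCoeff_det_one_add_smul _ _, one_mul, map_one] at h1
    rw [map_mul, h1, det_one_add_transfer_compl, map_prod,
      Finset.prod_eq_one fun j _ => constantCoeff_det_one_add_smul _ _, one_mul]

end FiniteColours

/-! ### Linear coefficients as sums over coloured words -/

section FiniteColours

variable {n : ℕ}

/-- The weight of a coloured word in the transfer matrix expansion is a monomial. -/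
theorem word_weight_eq_monomial (N m : ℕ) (D : Digraph (Fin n)) (w : Fin (m + 1) → Fin n × Fin N) :
    (∏ j, letter n N (w j)) * ∏ j : Fin m, transfer (XSeries n) N D (w j.castSucc) (w j.succ) =
      MvPowerSeries.monomial (∑ j, Finsupp.single (w j).1 1)
        ((∏ j, (MvPowerSeries.X ((w j).2 : ℕ) : ZSeries)) *
          ∏ j : Fin m, transfer ZSeries N D (w j.castSucc) (w j.succ)) := by
  have h1 : ∏ j, letter n N (w j) = _ :=
    prod_X_mul_C Finset.univ (fun j => (w j).1) fun j => MvPowerSeries.X ((w j).2 : ℕ)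
  simp_rw [h1, transfer_eq_C]
  rw [← map_prod, ← MvPowerSeries.monomial_zero_eq_C_apply, MvPowerSeries.monomial_mul_monomial,
    add_zero]

theorem degree_word {m N : ℕ} (w : Fin m → Fin n × Fin N) :
    (∑ j, Finsupp.single (w j).1 1 : Fin n →₀ ℕ).degree = m := by
  rw [map_sum]
  simp

open Classical in
theorem linCoeff_eq_sum_words (N k : ℕ) (D : Digraph (Fin (k + 1))) {v : XSeries (k + 1)}
    (hv : (1 - Matrix.diagonal (letter (k + 1) N) * transfer (XSeries (k + 1)) N D).det * v = 1) :
    linCoeff ((1 + Matrix.diagonal (letter (k + 1) N) *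
        (Matrix.of (fun _ _ => 1) - transfer (XSeries (k + 1)) N D)).det * v) =
      ∑ w : Fin (k + 1) → Fin (k + 1) × Fin N,
        if Function.Bijective (fun j => (w j).1) then
          (∏ j, (MvPowerSeries.X ((w j).2 : ℕ) : ZSeries)) *
            ∏ j : Fin k, transfer ZSeries N D (w j.castSucc) (w j.succ) else 0 := by
  have hu := IsUnit.of_mul_eq_one _ hv
  have hlin : ∀ f : XSeries (k + 1),
      linCoeff f = MvPowerSeries.coeff (ind Finset.univ) f := fun _ => rfl
  have hcard : (ind (Finset.univ : Finset (Fin (k + 1)))).degree = k + 1 := by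
    rw [degree_ind]; simp
  rw [det_one_add_diagonal_mul_compl _ _ hu, mul_right_comm, hv, one_mul,
    inv_one_sub_eq _ hu (k + 1), hlin]
  simp only [Matrix.add_mulVec, Pi.add_apply, Finset.sum_add_distrib, map_add]
  have h1 : MvPowerSeries.coeff (ind Finset.univ) (1 : XSeries (k + 1)) = 0 := by
    rw [MvPowerSeries.coeff_one, if_neg]
    intro h
    rw [h] at hcard
    simp at hcard
  -- Every term of the remainder is divisible by the monomial of a word of `k + 2` letters, whereas
  -- the target has degree `k + 1`.
  have h2 : MvPowerSeries.coeff (ind Finset.univ) (∑ a, (((1 - Matrix.diagonal (letter (k + 1) N) *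
      transfer (XSeries (k + 1)) N D)⁻¹ * (Matrix.diagonal (letter (k + 1) N) *
        transfer (XSeries (k + 1)) N D) ^ (k + 1)).mulVec (letter (k + 1) N)) a) = 0 := by
    rw [map_sum]
    refine Finset.sum_eq_zero fun a _ => ?_
    rw [← Matrix.mulVec_mulVec, Matrix.mulVec, dotProduct, map_sum]
    refine Finset.sum_eq_zero fun b _ => ?_
    rw [pow_mulVec_eq_sum, Finset.mul_sum, map_sum]
    refine Finset.sum_eq_zero fun u _ => ?_
    rw [word_weight_eq_monomial, MvPowerSeries.coeff_mul_monomial, if_neg]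
    intro h
    have := Finsupp.degree_mono h
    rw [degree_word, hcard] at this
    omega
  rw [h1, h2, zero_add, add_zero]
  have h3 : ∑ a, ((∑ i ∈ Finset.range (k + 1), (Matrix.diagonal (letter (k + 1) N) *
      transfer (XSeries (k + 1)) N D) ^ i).mulVec (letter (k + 1) N)) a =
      ∑ i ∈ Finset.range (k + 1), ∑ a, (((Matrix.diagonal (letter (k + 1) N) *
        transfer (XSeries (k + 1)) N D) ^ i).mulVec (letter (k + 1) N)) a := by
    rw [Finset.sum_comm]
    refine Finset.sum_congr rfl fun a _ => ?_
    rw [Matrix.sum_mulVec, Finset.sum_apply]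
  -- The `i`-th power produces words of `i + 1` letters, so only `i = k` reaches the required
  -- degree.
  rw [h3, map_sum, Finset.sum_eq_single k]
  · rw [sum_pow_mulVec, map_sum]
    refine Finset.sum_congr rfl fun w _ => ?_
    rw [word_weight_eq_monomial, MvPowerSeries.coeff_monomial]
    congr 1
    rw [eq_iff_iff, @eq_comm _ (ind _), sum_single_eq_ind_iff fun j => (w j).1]
    exact ⟨fun h => Finite.injective_iff_bijective.1 h.1,
      fun h => ⟨h.1, Finset.image_univ_of_surjective h.2⟩⟩
  · intro i _ hik
    rw [sum_pow_mulVec, map_sum]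
    refine Finset.sum_eq_zero fun w _ => ?_
    rw [word_weight_eq_monomial, MvPowerSeries.coeff_monomial, if_neg]
    intro h
    have := congrArg Finsupp.degree h
    rw [degree_word, hcard] at this
    omega
  · simp

/-- Monotonicity is a condition on consecutive positions. Together with strictness at descents it
says that each step raises the colour, or keeps it where there is no descent. -/
theorem prod_transfer_eq (N k : ℕ) (D : Digraph (Fin (k + 1))) (π : Equiv.Perm (Fin (k + 1)))
    (s : Fin (k + 1) → Fin N) [Decidable (Compatible D π fun j => (s j : ℕ))] :
    ∏ j : Fin k, transfer ZSeries N D (π j.castSucc, s j.castSucc) (π j.succ, s j.succ) =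
      if Compatible D π (fun j => (s j : ℕ)) then 1 else 0 := by
  classical
  simp only [transfer, Matrix.of_apply]
  rw [Finset.prod_ite_zero]
  simp only [Finset.prod_const_one]
  congr 1
  rw [eq_iff_iff, Compatible, Fin.monotone_iff_le_succ]
  constructor
  · intro h
    refine ⟨fun j => ?_, fun j hj hdes => ?_⟩
    · rcases h j (Finset.mem_univ _) with h1 | h1
      · exact h1.le
      · rw [h1.1]
    · rcases h ⟨j, by omega⟩ (Finset.mem_univ _) with h1 | h1
      · exact h1
      · exact absurd hdes.2 h1.2
  · rintro ⟨hmono, hdes⟩ j -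
    rcases (hmono j).lt_or_eq with h1 | h1
    · exact Or.inl h1
    · refine Or.inr ⟨Fin.ext h1, fun hadj => ?_⟩
      exact (hdes j (by omega) ⟨by omega, hadj⟩).ne h1

theorem linCoeff_eq_finiteU (N : ℕ) (D : Digraph (Fin n)) {v : XSeries n}
    (hv : (1 - Matrix.diagonal (letter n N) * transfer (XSeries n) N D).det * v = 1) :
    linCoeff ((1 + Matrix.diagonal (letter n N) *
        (Matrix.of (fun _ _ => 1) - transfer (XSeries n) N D)).det * v) = finiteU N D := by
  classical
  rcases n with _ | k
  · rw [Matrix.det_isEmpty, one_mul] at hv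
    rw [hv, Matrix.det_isEmpty, one_mul, finiteU, Fintype.sum_unique, Fintype.sum_unique, if_pos]
    · simp [linCoeff]
    · exact ⟨fun i => i.elim0, fun j hj => absurd hj (by omega)⟩
  rw [linCoeff_eq_sum_words N k D hv, finiteU]
  rw [← Finset.sum_filter, ← Finset.sum_product']
  symm
  refine Finset.sum_bij (fun x _ j => (x.1 j, x.2 j)) ?_ ?_ ?_ ?_
  · intro x _
    exact Finset.mem_filter.2 ⟨Finset.mem_univ _, x.1.bijective⟩
  · intro x _ y _ h
    refine Prod.ext (Equiv.ext fun j => ?_) (funext fun j => ?_)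
    · exact (Prod.ext_iff.1 (congrFun h j)).1
    · exact (Prod.ext_iff.1 (congrFun h j)).2
  · intro w hw
    exact ⟨(Equiv.ofBijective _ (Finset.mem_filter.1 hw).2, fun j => (w j).2),
      Finset.mem_product.2 ⟨Finset.mem_univ _, Finset.mem_univ _⟩, rfl⟩
  · intro x _
    rw [prod_transfer_eq]
    split_ifs <;> simp

end FiniteColours

/-! ### Infinitely many variables as a limit -/

section Limit

open Filter Topology
open scoped MvPowerSeries.WithPiTopology

variable {n : ℕ}

/-- A monomial uses finitely many variables, so each coefficient is eventually constant in `N`. -/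
theorem tendsto_of_eventually_coeff_eq {f : ℕ → ZSeries} {g : ZSeries}
    (h : ∀ d, ∀ N, (∀ i ∈ d.support, i < N) →
      MvPowerSeries.coeff d (f N) = MvPowerSeries.coeff d g) : Tendsto f atTop (𝓝 g) := by
  rw [MvPowerSeries.WithPiTopology.tendsto_iff_coeff_tendsto]
  intro d
  refine tendsto_const_nhds.congr' ?_
  filter_upwards [eventually_gt_atTop (d.support.sup id)] with N hN
  exact (h d N fun i hi => (Finset.le_sup (f := id) hi).trans_lt hN).symm

theorem finsum_subtype_eq_sum_fin (N : ℕ) (P : (Fin n → ℕ) → Prop) [DecidablePred P]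
    (g : (Fin n → ℕ) → ℚ) (hg : ∀ s, g s ≠ 0 → ∀ j, s j < N) :
    ∑ᶠ s : {s // P s}, g s.1 = ∑ s : Fin n → Fin N,
      if P (fun j => (s j : ℕ)) then g (fun j => (s j : ℕ)) else 0 := by
  classical
  rw [finsum_subtype_eq_finsum_cond]
  simp_rw [finsum_eq_if]
  have hinj : Function.Injective fun (s : Fin n → Fin N) (j : Fin n) => (s j : ℕ) :=
    fun s t h => funext fun j => Fin.ext (congrFun h j)
  rw [finsum_eq_sum_of_support_subset
    (s := Finset.univ.image fun (s : Fin n → Fin N) (j : Fin n) => (s j : ℕ)),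
    Finset.sum_image fun s _ t _ h => hinj h]
  intro s hs
  have hs' : g s ≠ 0 := by
    intro h
    simp [h] at hs
  simp only [Finset.coe_image, Finset.coe_univ, Set.image_univ, Set.mem_range]
  exact ⟨fun j => ⟨s j, hg s hs' j⟩, rfl⟩

theorem tendsto_finiteU (D : Digraph (Fin n)) :
    Tendsto (fun N => finiteU N D) atTop (𝓝 (U D)) := by
  classical
  refine tendsto_of_eventually_coeff_eq fun d N hN => ?_
  rw [finiteU, U, map_sum, map_sum]
  refine Finset.sum_congr rfl fun π _ => ?_
  have h1 : MvPowerSeries.coeff d (F n (descents D π)) =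
      ∑ᶠ s : {s // Compatible D π s},
        MvPowerSeries.coeff d (∏ j, (MvPowerSeries.X (s.1 j) : ZSeries)) := rfl
  have h2 : ∀ s : Fin n → ℕ, ∏ j, (MvPowerSeries.X (s j) : ZSeries) =
      MvPowerSeries.monomial (∑ j, Finsupp.single (s j) 1) 1 := fun s => by
    simpa using prod_X_mul_C Finset.univ s fun _ => (1 : ℚ)
  rw [h1, finsum_subtype_eq_sum_fin N (Compatible D π)
    (fun s => MvPowerSeries.coeff d (∏ j, (MvPowerSeries.X (s j) : ZSeries))), map_sum]
  · refine Finset.sum_congr rfl fun s _ => ?_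
    split_ifs <;> simp
  · intro s hs j
    rw [h2, MvPowerSeries.coeff_monomial] at hs
    have hd : d = ∑ j, Finsupp.single (s j) 1 := by
      by_contra h
      exact hs (if_neg h)
    refine hN _ ?_
    rw [Finsupp.mem_support_iff, hd, Finsupp.finsetSum_apply]
    intro h
    have := Finset.sum_eq_zero_iff.1 h j (Finset.mem_univ j)
    simp at this

theorem tendsto_finite_p {k : ℕ} (hk : k ≠ 0) :
    Tendsto (fun N => ∑ j : Fin N, (MvPowerSeries.X (j : ℕ) : ZSeries) ^ k) atTop (𝓝 (p k)) := by
  classical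
  refine tendsto_of_eventually_coeff_eq fun d N hN => ?_
  have h1 : MvPowerSeries.coeff d (p k) =
      ∑ᶠ i : ℕ, MvPowerSeries.coeff d ((MvPowerSeries.X i : ZSeries) ^ k) := rfl
  rw [h1, finsum_eq_sum_of_support_subset (s := Finset.range N), map_sum,
    Fin.sum_univ_eq_sum_range fun i => MvPowerSeries.coeff d ((MvPowerSeries.X i : ZSeries) ^ k)]
  intro i hi
  rw [Function.mem_support, MvPowerSeries.coeff_X_pow] at hi
  have hd : d = Finsupp.single i k := by
    by_contra h
    exact hi (if_neg h)
  rw [Finset.coe_range]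
  refine hN i ?_
  simp [hd, hk]

theorem tendsto_finitePowerSum (k : ℕ) :
    Tendsto (fun N => finitePowerSum N k) atTop (𝓝 (powerSum k)) := by
  by_cases hk : k = 0
  · simp only [finitePowerSum, powerSum, hk, if_true]
    exact tendsto_const_nhds
  · simp only [finitePowerSum, powerSum, hk, if_false]
    exact tendsto_finite_p hk

theorem tendsto_finiteSignedPowerSum (k : ℕ) :
    Tendsto (fun N => finiteSignedPowerSum N k) atTop (𝓝 (signedPowerSum k)) := by
  by_cases hk : k = 0
  · simp only [finiteSignedPowerSum, signedPowerSum, hk, if_true]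
    exact tendsto_const_nhds
  · simp only [finiteSignedPowerSum, signedPowerSum, hk, if_false]
    exact tendsto_const_nhds.mul (tendsto_finite_p hk)

/-- Permutation sums are polynomials in the values of `q`, hence continuous in them. Passing to the
limit in this form avoids any limit of determinants. -/
theorem tendsto_permSum {α : Type*} [Fintype α] [DecidableEq α] {q : ℕ → ℕ → ZSeries}
    {q' : ℕ → ZSeries} (hq : ∀ k, Tendsto (fun N => q N k) atTop (𝓝 (q' k)))
    (m : α → α → ZSeries) :
    Tendsto (fun N => permSum α (q N) m) atTop (𝓝 (permSum α q' m)) := by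
  refine tendsto_finsetSum _ fun σ _ => Tendsto.mul ?_ tendsto_const_nhds
  exact tendsto_multiset_prod _ fun k _ => hq k

theorem U_eq_sum_permSum (D : Digraph (Fin n)) :
    U D = ∑ I : Finset (Fin n),
      permSum {a // a ∈ Iᶜ} powerSum (fun a b => adj ZSeries Dᶜ a.1 b.1) *
        permSum {a // a ∈ I} signedPowerSum (fun a b => adj ZSeries D a.1 b.1) := by
  refine tendsto_nhds_unique (tendsto_finiteU D) (Tendsto.congr (fun N => ?_)
    (tendsto_finsetSum _ fun I _ => (tendsto_permSum tendsto_finitePowerSum _).mul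
      (tendsto_permSum tendsto_finiteSignedPowerSum _)))
  obtain ⟨v, hv⟩ := exists_inverse_det_one_sub_transfer N D
  rw [← linCoeff_eq_finiteU N D hv, linCoeff_transfer N D hv]

end Limit

/-! ### The three formulas -/

variable {n : ℕ}

/-- The common endpoint of (a) and (b): only the logarithmic Euler derivative and the constant term
of the candidate series need checking. -/
theorem U_eq_linCoeff (D : Digraph (Fin n)) {y : XSeries n}
    (hy : euler (Fin n) ZSeries y =
      y * (traceSeries powerSum (XA Dᶜ) + traceSeries signedPowerSum (XA D)))
    (h0 : MvPowerSeries.constantCoeff y = 1) : U D = linCoeff y := by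
  rw [XA_eq_weightMatrix, XA_eq_weightMatrix] at hy
  rw [U_eq_sum_permSum]
  exact (coeff_ind_univ_eq_sum (by simp [powerSum]) (by simp [signedPowerSum]) _ _ hy h0).symm

theorem homog_XA (D : Digraph (Fin n)) (i j : Fin n) : Homog 1 (XA D i j) := by
  rw [XA_eq_weightMatrix]
  exact homog_weightMatrix _ i j

theorem U_eq_linCoeff_det (D : Digraph (Fin n)) :
    U D = linCoeff ((evalMatrix H (XA Dᶜ)).det * (evalMatrix E (XA D)).det) := by
  refine U_eq_linCoeff D ?_ ?_
  · rw [Derivation.leibniz, euler_det_evalMatrix (homog_XA _) newton_h,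
      euler_det_evalMatrix (homog_XA _) newton_e, smul_eq_mul, smul_eq_mul]
    ring
  · rw [map_mul, constantCoeff_det_evalMatrix (homog_XA _) coeff_zero_H,
      constantCoeff_det_evalMatrix (homog_XA _) coeff_zero_E, one_mul]

theorem formalSum_eq_tracePotential (D : Digraph (Fin n)) :
    (formalSum fun k : ℕ => ((1 / ((k : ℚ) + 1)) • p (k + 1)) •
      (((XA Dᶜ) ^ (k + 1)).trace + (-1) ^ k * ((XA D) ^ (k + 1)).trace) : XSeries n) =
      tracePotential powerSum (XA Dᶜ) + tracePotential signedPowerSum (XA D) := by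
  refine MvPowerSeries.ext fun d => ?_
  have h1 : MvPowerSeries.coeff d (formalSum fun k : ℕ => ((1 / ((k : ℚ) + 1)) • p (k + 1)) •
      (((XA Dᶜ) ^ (k + 1)).trace + (-1) ^ k * ((XA D) ^ (k + 1)).trace) : XSeries n) =
      ∑ᶠ k : ℕ, MvPowerSeries.coeff d (((1 / ((k : ℚ) + 1)) • p (k + 1)) •
      (((XA Dᶜ) ^ (k + 1)).trace + (-1) ^ k * ((XA D) ^ (k + 1)).trace) : XSeries n) := rfl
  have h2 : ∀ k : ℕ, MvPowerSeries.coeff d (((1 / ((k : ℚ) + 1)) • p (k + 1)) •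
      (((XA Dᶜ) ^ (k + 1)).trace + (-1) ^ k * ((XA D) ^ (k + 1)).trace) : XSeries n) =
      ((1 / ((k : ℚ) + 1)) • p (k + 1)) * (MvPowerSeries.coeff d ((XA Dᶜ) ^ (k + 1)).trace +
        (-1) ^ k * MvPowerSeries.coeff d ((XA D) ^ (k + 1)).trace) := by
    intro k
    have hC : ((-1 : XSeries n)) ^ k = MvPowerSeries.C ((-1) ^ k) := by simp
    rw [MvPowerSeries.coeff_smul, map_add, hC, MvPowerSeries.coeff_C_mul]
  have h3 : ∀ k : ℕ, d.degree ≠ k + 1 → ((1 / ((k : ℚ) + 1)) • p (k + 1)) *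
      (MvPowerSeries.coeff d ((XA Dᶜ) ^ (k + 1)).trace +
        (-1) ^ k * MvPowerSeries.coeff d ((XA D) ^ (k + 1)).trace) = 0 := by
    intro k hk
    rw [homog_trace_pow (homog_XA _) _ d hk, homog_trace_pow (homog_XA _) _ d hk, mul_zero,
      add_zero, mul_zero]
  rw [h1, map_add, coeff_tracePotential, coeff_tracePotential]
  simp_rw [h2]
  rcases hd : d.degree with _ | k
  · rw [finsum_eq_zero_of_forall_eq_zero fun k => h3 k (by omega)]
    simp
  · rw [finsum_eq_single _ k fun l hl => h3 l (by omega)]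
    simp only [powerSum, signedPowerSum, k.succ_ne_zero, if_false, Nat.add_sub_cancel,
      Nat.cast_succ]
    rw [← smul_add, smul_mul_assoc]
    congr 1
    ring

theorem U_eq_linCoeff_exp (D : Digraph (Fin n)) :
    U D = linCoeff (expSeries (formalSum fun k : ℕ => ((1 / ((k : ℚ) + 1)) • p (k + 1)) •
      (((XA Dᶜ) ^ (k + 1)).trace + (-1) ^ k * ((XA D) ^ (k + 1)).trace))) := by
  have h0 : MvPowerSeries.constantCoeff
      (tracePotential powerSum (XA Dᶜ) + tracePotential signedPowerSum (XA D)) = 0 := by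
    rw [map_add, constantCoeff_tracePotential, constantCoeff_tracePotential, add_zero]
  rw [formalSum_eq_tracePotential]
  refine U_eq_linCoeff D ?_ (constantCoeff_subst_exp h0)
  rw [expSeries, euler_subst_exp h0, map_add, euler_tracePotential (by simp [powerSum]),
    euler_tracePotential (by simp [signedPowerSum])]

theorem cycProd_powerSum {α : Type*} [Fintype α] [DecidableEq α] (σ : Equiv.Perm α) :
    cycProd powerSum σ = pCyc σ := by
  rw [cycProd, pCyc]
  refine congrArg _ (Multiset.map_congr rfl fun k hk => ?_)
  rw [powerSum, if_neg (σ.partition.parts_pos hk).ne']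

/-- The sign of a permutation is the product of `(-1)^(k-1)` over its cycle lengths `k`; fixed
points contribute `1`. -/
theorem cycProd_signedPowerSum {α : Type*} [Fintype α] [DecidableEq α] (σ : Equiv.Perm α) :
    cycProd signedPowerSum σ = pCyc σ * (((Equiv.Perm.sign σ : ℤˣ) : ℤ) : ZSeries) := by
  have h1 : cycProd signedPowerSum σ =
      (σ.partition.parts.map fun k => p k * (-1 : ZSeries) ^ (k - 1)).prod := by
    refine congrArg _ (Multiset.map_congr rfl fun k hk => ?_)
    rw [signedPowerSum, if_neg (σ.partition.parts_pos hk).ne', mul_comm]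
  have h2 : (σ.cycleType.map fun k => (-1 : ZSeries) ^ (k - 1)).prod =
      (((Equiv.Perm.sign σ : ℤˣ) : ℤ) : ZSeries) := by
    have h3 : ∀ x : ℤˣ, ((x : ℤ) : ZSeries) =
      ((Int.castRingHom ZSeries).toMonoidHom.comp (Units.coeHom ℤ)) x := fun _ => rfl
    rw [Equiv.Perm.sign_of_cycleType', h3, map_multiset_prod, Multiset.map_map]
    refine congrArg _ (Multiset.map_congr rfl fun k hk => ?_)
    obtain ⟨l, rfl⟩ : ∃ l, k = l + 1 :=
      ⟨k - 1, by have := Equiv.Perm.two_le_of_mem_cycleType hk; omega⟩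
    simp [pow_succ]
  rw [h1, Multiset.prod_map_mul, ← pCyc, parts_partition_eq, Multiset.map_add, Multiset.prod_add,
    h2]
  simp

theorem U_eq_sum_pCyc (D : Digraph (Fin n)) :
    U D = ∑ I : Finset (Fin n),
      (∑ σ : Equiv.Perm (Iᶜ : Finset (Fin n)),
        pCyc σ * ∏ i : (Iᶜ : Finset (Fin n)), adj ZSeries Dᶜ i (σ i)) *
      (∑ τ : Equiv.Perm I, pCyc τ * (((Equiv.Perm.sign τ : ℤˣ) : ℤ) : ZSeries) *
        ∏ i : I, adj ZSeries D i (τ i)) := by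
  rw [U_eq_sum_permSum]
  simp only [permSum, cycProd_powerSum, cycProd_signedPowerSum]

end RedeiBerge

end

theorem theorem10 (n : ℕ) (D : Digraph (Fin n)) :
    RedeiBerge.U D =
        RedeiBerge.linCoeff
          ((RedeiBerge.evalMatrix RedeiBerge.H (RedeiBerge.XA Dᶜ)).det *
            (RedeiBerge.evalMatrix RedeiBerge.E (RedeiBerge.XA D)).det) ∧
      RedeiBerge.U D =
        RedeiBerge.linCoeff
          (RedeiBerge.expSeries
            (RedeiBerge.formalSum fun k : ℕ =>
              ((1 / ((k : ℚ) + 1)) • RedeiBerge.p (k + 1)) •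
                (((RedeiBerge.XA Dᶜ) ^ (k + 1)).trace +
                  (-1) ^ k * ((RedeiBerge.XA D) ^ (k + 1)).trace))) ∧
      RedeiBerge.U D =
        ∑ I : Finset (Fin n),
          (∑ σ : Equiv.Perm (Iᶜ : Finset (Fin n)),
              RedeiBerge.pCyc σ *
                ∏ i : (Iᶜ : Finset (Fin n)), RedeiBerge.adj RedeiBerge.ZSeries Dᶜ i (σ i)) *
          (∑ τ : Equiv.Perm I,
              RedeiBerge.pCyc τ * (((Equiv.Perm.sign τ : ℤˣ) : ℤ) : RedeiBerge.ZSeries) *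
                ∏ i : I, RedeiBerge.adj RedeiBerge.ZSeries D i (τ i)) :=
  ⟨RedeiBerge.U_eq_linCoeff_det D, RedeiBerge.U_eq_linCoeff_exp D, RedeiBerge.U_eq_sum_pCyc D⟩
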